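/- For $\alpha,c>0$ let $$\Theta(\alpha,c)=\Big\{\theta\in\mathbb R^{\mathbb N}:\ \sum_{i\ge1} i^{2\alpha}\theta_i^2\le c^2\Big\}.$$ There are $m$ machines. For $j=1,\dots,m$, machine $j$ observes $X_{1j},X_{2j},\dots$, where all the $X_{ij}\sim N(\theta_i,1/n)$ are independent. A distributed protocol consists of message lengths $b_1,\dots,b_m\in\{0,1,2,\dots\}$, measurable, possibly randomized messages $\Pi_j=\Pi_j(X_{1j},X_{2j},\dots)\in\{1,\dots,2^{b_j}\}$, and an estimator $\hat\theta=\hat\theta(\Pi_1,\dots,\Pi_m)\in\mathbb R^{\mathbb N}$; the randomization is by a random seed, independent of the data, which the machines and the estimator may share. (Deterministic protocols, and protocols with independent private randomness at the machines, are special cases.) For a real budget $b$, a protocol obeys the sum constraint if $\sum_{j=1}^m b_j\le mb$, and the individual constraint if $b_j\le b$ for every $j$. For either constraint let $$R(n,m,b;\Theta(\alpha,c))=\inf\ \sup_{\theta\in\Theta(\alpha,c)}\ \mathbb E\,\|\hat\theta(\Pi_1,\dots,\Pi_m)-\theta\|^2,$$ where $\|\cdot\|$ is the $\ell_2$ norm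 (with value $\infty$ if the sum diverges) and the infimum is over the protocols on $m$ machines that obey the constraint. **Theorem.** For all real $\alpha,c>0$ there is a constant $C>0$, depending only on $\alpha$ and $c$, such that for either constraint and for every sequence $(n,m,b)=(n_k,m_k,b_k)_{k}$ of positive integers $n,m$ and real $b$ with $mb\ge1$ for all $k$ and $mn\to\infty$ as $k\to\infty$: 1. If $b(mn)^{-\frac1{2\alpha+1}}\to\infty$, then $\displaystyle\liminf_{k\to\infty}\ (mn)^{\frac{2\alpha}{2\alpha+1}}R(n,m,b;\Theta(\alpha,c))\ge C$. 2. If $b(mn)^{-\frac1{2\alpha+1}}=O(1)$ and $mb\,n^{-\frac1{2\alpha+1}}\to\infty$, then $\displaystyle\liminf_{k\to\infty}\ (mnb)^{\frac{\alpha}{\alpha+1}}R(n,m,b;\Theta(\alpha,c))\ge C$. 3. If $mb\,n^{-\frac1{2\alpha+1}}=O(1)$, then $\displaystyle\liminf_{k\to\infty}\ (mb)^{2\alpha}R(n,m,b;\Theta(\alpha,c))\ge C$. -/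

import Mathlib

open Filter Topology MeasureTheory ProbabilityTheory Asymptotics
open scoped ENNReal NNReal

noncomputable section

namespace DistEst

/-- The Sobolev ellipsoid `Θ(α, c) = {θ : ∑_{i ≥ 1} i ^ (2α) θ_i ^ 2 ≤ c ^ 2}`.  Sequences are indexed
from `0`, so the coordinate `θ i` carries the weight `(i + 1) ^ (2α)`.  The sum is taken in
`[0, ∞]`, so that a divergent sum is not in the ellipsoid. -/
def ellipsoid (α c : ℝ) : Set (ℕ → ℝ) :=
  {θ | ∑' i : ℕ, ENNReal.ofReal (((i : ℝ) + 1) ^ (2 * α) * θ i ^ 2) ≤ ENNReal.ofReal (c ^ 2)}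

/-- The law of the data `(X_1, X_2, …)` seen by one machine: independent `X_i ∼ N(θ_i, 1/n)`. -/
def obsLaw (n : ℕ) (θ : ℕ → ℝ) : Measure (ℕ → ℝ) :=
  Measure.infinitePi fun i => gaussianReal (θ i) (1 / (n : ℝ≥0))

/-- A one-round distributed protocol on `m` machines.  Machine `j` sends a message of `bits j` bits,
which is a function of its own data and of a random seed; the estimator is a function of the
messages and of the seed.  The seed is independent of the data and may be visible to all parties.
Deterministic protocols (the seed is ignored) and protocols with independent private
randomness (the seed is a tuple, of which machine `j` reads the `j`-th entry) are special cases. -/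
structure Protocol (m : ℕ) where
  /-- The space of seeds. -/
  Seed : Type
  /-- Its measurable sets. -/
  [measurableSpaceSeed : MeasurableSpace Seed]
  /-- The law of the seed. -/
  seedLaw : Measure Seed
  [isProbabilityMeasure_seedLaw : IsProbabilityMeasure seedLaw]
  /-- The lengths of the messages. -/
  bits : Fin m → ℕ
  /-- The message that machine `j` computes from the seed and its data. -/
  encode : (j : Fin m) → Seed → (ℕ → ℝ) → Fin (2 ^ bits j)
  measurable_encode : ∀ j, Measurable fun p : Seed × (ℕ → ℝ) => encode j p.1 p.2
  /-- The final estimate of the whole sequence. -/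
  estimate : Seed → ((j : Fin m) → Fin (2 ^ bits j)) → ℕ → ℝ
  measurable_estimate : ∀ w i, Measurable fun s => estimate s w i

attribute [instance] Protocol.measurableSpaceSeed Protocol.isProbabilityMeasure_seedLaw

/-- The squared error `‖t - θ‖ ^ 2 = ∑_i (t_i - θ_i) ^ 2`, with value `∞` if the sum diverges. -/
def sqError (t θ : ℕ → ℝ) : ℝ≥0∞ :=
  ∑' i, ENNReal.ofReal ((t i - θ i) ^ 2)

/-- The risk `E_θ ‖θ̂(Π_1, …, Π_m) - θ‖ ^ 2`: the data of the `m` machines are independent copies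
with law `obsLaw n θ`, independent of the seed. -/
def Protocol.risk {m : ℕ} (P : Protocol m) (n : ℕ) (θ : ℕ → ℝ) : ℝ≥0∞ :=
  ∫⁻ p : P.Seed × (Fin m → ℕ → ℝ),
    sqError (P.estimate p.1 fun j => P.encode j p.1 (p.2 j)) θ
    ∂(P.seedLaw.prod (Measure.pi fun _ : Fin m => obsLaw n θ))

/-- The two kinds of communication constraint. -/
inductive BudgetType
  | individual
  | sum

/-- The protocols on `m` machines that obey the constraint with budget `b`: `b_j ≤ b` for every `j`
(individual constraint), or `∑_j b_j ≤ m b` (sum constraint). -/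
def admissible (t : BudgetType) (m : ℕ) (b : ℝ) : Set (Protocol m) :=
  match t with
  | .individual => {P | ∀ j, (P.bits j : ℝ) ≤ b}
  | .sum => {P | ∑ j, (P.bits j : ℝ) ≤ m * b}

/-- The distributed minimax risk `R(n, m, b; Θ(α, c))`. -/
def distMinimaxRisk (t : BudgetType) (n m : ℕ) (b α c : ℝ) : ℝ≥0∞ :=
  ⨅ P ∈ admissible t m b, ⨆ θ ∈ ellipsoid α c, P.risk n θ

end DistEst

end

/-! The risk is bounded below by a Bayes risk over the cube `{-δ, δ} ^ d` in the first `d`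
coordinates, with `δ ^ 2` of order `d ^ (-(2α + 1))` so that the cube lies in the ellipsoid. For a
fixed seed the messages are deterministic functions of independent data, so bounds uniform in the
seed suffice. If `d` is chosen so that a fixed fraction of the signs cannot be recovered, the risk
is at least of order `d δ ^ 2`, that is `d ^ (-2α)`.

Let `B` be the total number of bits. Three obstructions limit recovery: (a) Few messages
(`seedRisk_ge_of_bits`): an estimator with `2 ^ B` values is near few vertices, so `d` much larger
than `B` is hopeless. (b) Few data (`seedRisk_ge_of_samples`): `m n δ ^ 2` must not be small. (c)
Both (`seedRisk_ge_of_samples_of_bits`): when `n δ ^ 2` is small, `n δ ^ 2 * B` must be at least of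
order `d`. Balancing gives `d` of order `m b`, `(m n) ^ (1 / (2α + 1))` and `(m n b) ^ (1 / (2α +
2))` respectively.

For (b) and (c), Assouad's method compares each vertex with its neighbours. Hellinger affinity
tensorizes over machines and leaves a sum of triangular discriminations, one per machine and
coordinate (`cube_risk_ge_of_triDiscr`). Each is controlled by correlations of the message events
with a score (`sq_sub_div_add_le_corr`). The score is a clipped likelihood ratio: being bounded and
Lipschitz it is sub-Gaussian with variance proxy of order `n δ ^ 2`, yet it still determines the
difference of the two probabilities of an event. Scores of distinct coordinates are independent.
Hence the squared correlations, summed over coordinates and message values, are at most of order `d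
n δ ^ 2` by Cauchy–Schwarz (`sum_corr_le_dim`), and at most of order `n δ ^ 2` times the entropy of
the message by an exponential moment argument (`sum_corr_le_log_card`). -/

namespace DistEst

/-! ### The cube and the bound by counting messages -/

/-- The sign `±1` attached to a Boolean. -/
noncomputable def boolSign (x : Bool) : ℝ := if x then 1 else -1

lemma boolSign_sq (x : Bool) : boolSign x ^ 2 = 1 := by cases x <;> simp [boolSign]

lemma boolSign_not (x : Bool) : boolSign (!x) = -boolSign x := by cases x <;> simp [boolSign]

/-- Flip the `i`-th coordinate of a vertex of the cube. -/
def flipAt {d : ℕ} (i : Fin d) (σ : Fin d → Bool) : Fin d → Bool := Function.update σ i (!σ i)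

lemma flipAt_same {d : ℕ} (i : Fin d) (σ : Fin d → Bool) : flipAt i σ i = !σ i := by
  simp [flipAt]

lemma flipAt_of_ne {d : ℕ} {i k : Fin d} (h : k ≠ i) (σ : Fin d → Bool) : flipAt i σ k = σ k := by
  simp [flipAt, h]

lemma flipAt_involutive {d : ℕ} (i : Fin d) : Function.Involutive (flipAt i) := by
  intro σ
  ext k
  by_cases h : k = i
  · subst h; simp [flipAt_same]
  · simp [flipAt_of_ne h]

lemma sum_flipAt {d : ℕ} (i : Fin d) (f : (Fin d → Bool) → ℝ) :
    ∑ σ, f (flipAt i σ) = ∑ σ, f σ :=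
  Equiv.sum_comp (flipAt_involutive i).toPerm f

/-- With `v = u / δ` the sum is `2 exp (-1/2) exp (-v ^ 2 / 2) cosh v`, and `cosh v ≤ exp (v ^ 2 /
2)`. -/
lemma sum_bool_exp_le (u δ : ℝ) (hδ : 0 < δ) :
    ∑ x : Bool, Real.exp (-((u - δ * boolSign x) ^ 2 / (2 * δ ^ 2))) ≤ 2 * Real.exp (-(1 / 2)) := by
  obtain ⟨v, rfl⟩ : ∃ v, u = δ * v := ⟨u / δ, by field_simp⟩
  have h1 : ∀ s : ℝ, -((δ * v - δ * s) ^ 2 / (2 * δ ^ 2)) = -((v - s) ^ 2 / 2) := by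
    intro s; field_simp
  simp only [Fintype.sum_bool, h1]
  have h2 := Real.cosh_le_exp_half_sq v
  rw [Real.cosh_eq] at h2
  have e1 : Real.exp (-((v - boolSign true) ^ 2 / 2))
      = Real.exp (-(1 / 2)) * Real.exp (-(v ^ 2 / 2)) * Real.exp v := by
    rw [← Real.exp_add, ← Real.exp_add]; congr 1; simp [boolSign]; ring
  have e2 : Real.exp (-((v - boolSign false) ^ 2 / 2))
      = Real.exp (-(1 / 2)) * Real.exp (-(v ^ 2 / 2)) * Real.exp (-v) := by
    rw [← Real.exp_add, ← Real.exp_add]; congr 1; simp [boolSign]; ring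
  rw [e1, e2]
  have h3 : Real.exp (-(v ^ 2 / 2)) * Real.exp (v ^ 2 / 2) = 1 := by
    rw [← Real.exp_add]; simp
  calc _ = 2 * Real.exp (-(1 / 2)) * (Real.exp (-(v ^ 2 / 2)) *
        ((Real.exp v + Real.exp (-v)) / 2)) := by ring
    _ ≤ 2 * Real.exp (-(1 / 2)) * (Real.exp (-(v ^ 2 / 2)) * Real.exp (v ^ 2 / 2)) := by gcongr
    _ = _ := by rw [h3, mul_one]

/-- The sum factorizes over coordinates. It quantifies that no single point is close to many
vertices. -/
lemma sum_exp_sqDist_le {d : ℕ} (t : Fin d → ℝ) {δ : ℝ} (hδ : 0 < δ) :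
    ∑ σ : Fin d → Bool, Real.exp (-((∑ i, (t i - δ * boolSign (σ i)) ^ 2) / (2 * δ ^ 2)))
      ≤ 2 ^ d * Real.exp (-(d / 2)) := by
  have h : ∀ σ : Fin d → Bool,
      Real.exp (-((∑ i, (t i - δ * boolSign (σ i)) ^ 2) / (2 * δ ^ 2)))
        = ∏ i, Real.exp (-((t i - δ * boolSign (σ i)) ^ 2 / (2 * δ ^ 2))) := by
    intro σ
    rw [← Real.exp_sum, Finset.sum_neg_distrib, Finset.sum_div]
  simp_rw [h]
  rw [← Fintype.prod_sum fun i (x : Bool) =>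
    Real.exp (-((t i - δ * boolSign x) ^ 2 / (2 * δ ^ 2)))]
  calc _ ≤ ∏ _i : Fin d, 2 * Real.exp (-(1 / 2)) :=
        Finset.prod_le_prod (fun _ _ => Finset.sum_nonneg fun _ _ => (Real.exp_pos _).le)
          fun i _ => sum_bool_exp_le (t i) δ hδ
    _ = _ := by
        rw [Finset.prod_const, Finset.card_univ, Fintype.card_fin, mul_pow, ← Real.exp_nat_mul]
        congr 2; ring

/-- Bayes risk over the cube `{-δ, δ} ^ d` when the estimator takes few values. -/
lemma cube_risk_ge_of_card {d : ℕ} {Y : Type*} [Fintype Y] [Nonempty Y] {δ : ℝ} (hδ : 0 < δ)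
    (p : (Fin d → Bool) → Y → ℝ) (hp : ∀ σ y, 0 ≤ p σ y) (hp1 : ∀ σ, ∑ y, p σ y = 1)
    (t : Y → Fin d → ℝ) :
    2 ^ d * (δ ^ 2 * (d - 2 * Real.log (Fintype.card Y))) ≤
      ∑ σ, ∑ y, p σ y * ∑ i, (t y i - δ * boolSign (σ i)) ^ 2 := by
  set x : (Fin d → Bool) → Y → ℝ :=
    fun σ y => (∑ i, (t y i - δ * boolSign (σ i)) ^ 2) / (2 * δ ^ 2) with hx
  set M : ℝ := ((Fintype.card Y : ℕ) : ℝ) with hMdef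
  have hM : 0 < M := by positivity
  set a : ℝ := d / 2 - Real.log M with ha
  have hea : Real.exp (-a) = M * Real.exp (-(d / 2)) := by
    rw [ha, neg_sub, sub_eq_add_neg, Real.exp_add, Real.exp_log hM]
  have hple : ∀ σ y, p σ y ≤ 1 := fun σ y =>
    (hp1 σ) ▸ Finset.single_le_sum (fun z _ => hp σ z) (Finset.mem_univ y)
  -- Dropping `p σ y ≤ 1` costs a factor `M`, the number of values of the estimator; this factor is
  -- absorbed in `a`.
  have upper : ∑ σ, ∑ y, p σ y * Real.exp (-x σ y) ≤ 2 ^ d * Real.exp (-a) := by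
    calc _ ≤ ∑ σ, ∑ y, Real.exp (-x σ y) :=
          Finset.sum_le_sum fun σ _ => Finset.sum_le_sum fun y _ =>
            mul_le_of_le_one_left (Real.exp_pos _).le (hple σ y)
      _ = ∑ y, ∑ σ, Real.exp (-x σ y) := Finset.sum_comm
      _ ≤ ∑ _y : Y, 2 ^ d * Real.exp (-(d / 2)) :=
          Finset.sum_le_sum fun y _ => sum_exp_sqDist_le (t y) hδ
      _ = _ := by rw [Finset.sum_const, Finset.card_univ, nsmul_eq_mul, hea]; ring
  -- The tangent to `exp (-x)` at `x = a` is affine in `x`, so the mean squared distance appears;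
  -- this is Jensen's inequality in effect.
  have lower : ∑ σ, ∑ y, p σ y * (Real.exp (-a) * (1 + a - x σ y)) ≤
      ∑ σ, ∑ y, p σ y * Real.exp (-x σ y) := by
    refine Finset.sum_le_sum fun σ _ => Finset.sum_le_sum fun y _ =>
      mul_le_mul_of_nonneg_left ?_ (hp σ y)
    have := Real.add_one_le_exp (a - x σ y)
    calc _ ≤ Real.exp (-a) * Real.exp (a - x σ y) := by gcongr; linarith
      _ = _ := by rw [← Real.exp_add]; congr 1; ring
  have expand : ∑ σ, ∑ y, p σ y * (Real.exp (-a) * (1 + a - x σ y)) =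
      Real.exp (-a) * (2 ^ d * (1 + a) - ∑ σ, ∑ y, p σ y * x σ y) := by
    have : ∀ σ, ∑ y, p σ y * (Real.exp (-a) * (1 + a - x σ y)) =
        Real.exp (-a) * ((1 + a) - ∑ y, p σ y * x σ y) := by
      intro σ
      calc _ = Real.exp (-a) * ((1 + a) * ∑ y, p σ y - ∑ y, p σ y * x σ y) := by
            rw [Finset.mul_sum, ← Finset.sum_sub_distrib, Finset.mul_sum]
            exact Finset.sum_congr rfl fun y _ => by ring
        _ = _ := by rw [hp1, mul_one]
    simp_rw [this]
    rw [← Finset.mul_sum, Finset.sum_sub_distrib]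
    simp [mul_add]
  have key : 2 ^ d * a ≤ ∑ σ, ∑ y, p σ y * x σ y := by
    have h := lower.trans upper
    rw [expand, mul_comm ((2 : ℝ) ^ d) (Real.exp (-a))] at h
    have := le_of_mul_le_mul_left h (Real.exp_pos _)
    linarith
  have hfin : ∑ σ, ∑ y, p σ y * ∑ i, (t y i - δ * boolSign (σ i)) ^ 2 =
      2 * δ ^ 2 * ∑ σ, ∑ y, p σ y * x σ y := by
    simp_rw [Finset.mul_sum (a := 2 * δ ^ 2)]
    refine Finset.sum_congr rfl fun σ _ => Finset.sum_congr rfl fun y _ => ?_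
    simp only [hx]; field_simp
  rw [hfin]
  calc _ = 2 * δ ^ 2 * (2 ^ d * a) := by rw [ha]; ring
    _ ≤ _ := by gcongr

/-! ### Hellinger affinity and Assouad's bound -/

lemma one_sub_sum_le_prod {ι : Type*} (s : Finset ι) (u : ι → ℝ) (h0 : ∀ j, 0 ≤ u j)
    (h1 : ∀ j, u j ≤ 1) : 1 - ∑ j ∈ s, (1 - u j) ≤ ∏ j ∈ s, u j := by
  classical
  induction s using Finset.induction_on with
  | empty => simp
  | insert j s hj ih =>
    rw [Finset.sum_insert hj, Finset.prod_insert hj]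
    have hp : ∏ k ∈ s, u k ≤ 1 := Finset.prod_le_one (fun k _ => h0 k) fun k _ => h1 k
    nlinarith [h0 j, h1 j]

/-- The triangular discrimination `∑ (p - q) ^ 2 / (p + q)` of two functions on a finite type. -/
noncomputable def triDiscr {Y : Type*} [Fintype Y] (p q : Y → ℝ) : ℝ :=
  ∑ y, (p y - q y) ^ 2 / (p y + q y)

/-- Pointwise, the left side is the harmonic mean `2 p q / (p + q)`, which is at most the geometric
mean. -/
lemma one_sub_half_triDiscr_le {Y : Type*} [Fintype Y] {p q : Y → ℝ} (hp : ∀ y, 0 ≤ p y)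
    (hq : ∀ y, 0 ≤ q y) (hp1 : ∑ y, p y = 1) (hq1 : ∑ y, q y = 1) :
    1 - triDiscr p q / 2 ≤ ∑ y, √(p y * q y) := by
  have h : ∀ y, (p y + q y) / 2 - (p y - q y) ^ 2 / (p y + q y) / 2 ≤ √(p y * q y) := by
    intro y
    rcases (add_nonneg (hp y) (hq y)).eq_or_lt with h0 | h0
    · rw [← h0]; simp
    · apply Real.le_sqrt_of_sq_le
      have hmul := mul_nonneg (hp y) (hq y)
      have e : (p y + q y) / 2 - (p y - q y) ^ 2 / (p y + q y) / 2
          = 2 * (p y * q y) / (p y + q y) := by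
        field_simp; ring
      rw [e, div_pow, div_le_iff₀ (by positivity)]
      nlinarith [sq_nonneg (p y - q y)]
  calc _ = ∑ y, ((p y + q y) / 2 - (p y - q y) ^ 2 / (p y + q y) / 2) := by
        rw [Finset.sum_sub_distrib, ← Finset.sum_div, ← Finset.sum_div, Finset.sum_add_distrib,
          hp1, hq1, triDiscr]
        norm_num
    _ ≤ _ := Finset.sum_le_sum fun y _ => h y

lemma sum_sqrt_mul_le_one {Y : Type*} [Fintype Y] {p q : Y → ℝ} (hp : ∀ y, 0 ≤ p y)
    (hq : ∀ y, 0 ≤ q y) (hp1 : ∑ y, p y = 1) (hq1 : ∑ y, q y = 1) :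
    ∑ y, √(p y * q y) ≤ 1 := by
  calc _ ≤ ∑ y, (p y + q y) / 2 := Finset.sum_le_sum fun y _ => by
        apply Real.sqrt_le_iff.2
        exact ⟨by linarith [hp y, hq y], by nlinarith [sq_nonneg (p y - q y)]⟩
    _ = 1 := by rw [← Finset.sum_div, Finset.sum_add_distrib, hp1, hq1]; norm_num

/-- Cauchy–Schwarz applied to `p q = min * max`; the maxima sum to at most `2`. -/
lemma sq_sum_sqrt_mul_le {Y : Type*} [Fintype Y] {p q : Y → ℝ} (hp : ∀ y, 0 ≤ p y)
    (hq : ∀ y, 0 ≤ q y) (hp1 : ∑ y, p y = 1) (hq1 : ∑ y, q y = 1) :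
    (∑ y, √(p y * q y)) ^ 2 ≤ 2 * ∑ y, min (p y) (q y) := by
  have e : ∀ y, √(p y * q y) = √(min (p y) (q y)) * √(max (p y) (q y)) := fun y => by
    rw [← Real.sqrt_mul (le_min (hp y) (hq y)), min_mul_max]
  simp_rw [e]
  refine (Finset.sum_mul_sq_le_sq_mul_sq _ _ _).trans ?_
  have e1 : ∀ y, √(min (p y) (q y)) ^ 2 = min (p y) (q y) := fun y =>
    Real.sq_sqrt (le_min (hp y) (hq y))
  have e2 : ∀ y, √(max (p y) (q y)) ^ 2 = max (p y) (q y) := fun y =>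
    Real.sq_sqrt ((hp y).trans (le_max_left _ _))
  simp_rw [e1, e2]
  rw [mul_comm]
  refine mul_le_mul_of_nonneg_right ?_ (Finset.sum_nonneg fun y _ => le_min (hp y) (hq y))
  calc _ ≤ ∑ y, (p y + q y) := Finset.sum_le_sum fun y _ =>
        max_le (by linarith [hq y]) (by linarith [hp y])
    _ = 2 := by rw [Finset.sum_add_distrib, hp1, hq1]; norm_num

lemma sum_prod_eq_one {ι : Type*} [Fintype ι] {Y : ι → Type*} [DecidableEq ι]
    [∀ j, Fintype (Y j)] {p : ∀ j, Y j → ℝ} (hp1 : ∀ j, ∑ y, p j y = 1) :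
    ∑ y : ∀ j, Y j, ∏ j, p j (y j) = 1 := by
  rw [← Fintype.prod_sum]; simp [hp1]

/-- The affinity of products is the product of the affinities `ρ j`. Its square is at least `1 - ∑
(1 - ρ j ^ 2)`, and `1 - ρ ^ 2 ≤ 2 (1 - ρ)` is at most the triangular discrimination. -/
lemma sum_min_prod_ge {ι : Type*} [Fintype ι] [DecidableEq ι] {Y : ι → Type*}
    [∀ j, Fintype (Y j)] {p q : ∀ j, Y j → ℝ}
    (hp : ∀ j y, 0 ≤ p j y) (hq : ∀ j y, 0 ≤ q j y) (hp1 : ∀ j, ∑ y, p j y = 1)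
    (hq1 : ∀ j, ∑ y, q j y = 1) :
    (1 - ∑ j, triDiscr (p j) (q j)) / 2 ≤
      ∑ y : ∀ j, Y j, min (∏ j, p j (y j)) (∏ j, q j (y j)) := by
  have h := sq_sum_sqrt_mul_le (p := fun y : ∀ j, Y j => ∏ j, p j (y j))
    (q := fun y : ∀ j, Y j => ∏ j, q j (y j))
    (fun y => Finset.prod_nonneg fun j _ => hp j _) (fun y => Finset.prod_nonneg fun j _ => hq j _)
    (sum_prod_eq_one hp1) (sum_prod_eq_one hq1)
  have e : ∑ y : ∀ j, Y j, √((∏ j, p j (y j)) * ∏ j, q j (y j))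
      = ∏ j, ∑ y, √(p j y * q j y) := by
    rw [Fintype.prod_sum]
    refine Finset.sum_congr rfl fun y _ => ?_
    rw [← Finset.prod_mul_distrib, Real.sqrt_prod _ fun j _ => mul_nonneg (hp j _) (hq j _)]
  rw [e, ← Finset.prod_pow] at h
  have hle : ∀ j, ∑ y, √(p j y * q j y) ≤ 1 := fun j =>
    sum_sqrt_mul_le_one (hp j) (hq j) (hp1 j) (hq1 j)
  have h0 : ∀ j, 0 ≤ ∑ y, √(p j y * q j y) := fun j =>
    Finset.sum_nonneg fun _ _ => Real.sqrt_nonneg _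
  have h2 := one_sub_sum_le_prod Finset.univ (fun j => (∑ y, √(p j y * q j y)) ^ 2)
    (fun j => sq_nonneg _) (fun j => pow_le_one₀ (h0 j) (hle j))
  have h3 : ∑ j, (1 - (∑ y, √(p j y * q j y)) ^ 2) ≤ ∑ j, triDiscr (p j) (q j) := by
    refine Finset.sum_le_sum fun j _ => ?_
    have := one_sub_half_triDiscr_le (hp j) (hq j) (hp1 j) (hq1 j)
    nlinarith [sq_nonneg (1 - ∑ y, √(p j y * q j y))]
  linarith

/-- Assouad's bound for the Bayes risk over the cube `{-δ, δ} ^ d` with independent messages. -/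
lemma cube_risk_ge_of_triDiscr {d : ℕ} {ι : Type*} [Fintype ι] [DecidableEq ι] {Y : ι → Type*}
    [∀ j, Fintype (Y j)] (δ : ℝ) (p : (Fin d → Bool) → ∀ j, Y j → ℝ)
    (hp : ∀ σ j y, 0 ≤ p σ j y) (hp1 : ∀ σ j, ∑ y, p σ j y = 1) (t : (∀ j, Y j) → Fin d → ℝ) :
    δ ^ 2 / 2 * (2 ^ d * d - ∑ σ, ∑ i, ∑ j, triDiscr (p σ j) (p (flipAt i σ) j)) ≤
      ∑ σ, ∑ y, (∏ j, p σ j (y j)) * ∑ i, (t y i - δ * boolSign (σ i)) ^ 2 := by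
  set q : (Fin d → Bool) → (∀ j, Y j) → ℝ := fun σ y => ∏ j, p σ j (y j) with hq
  have hq0 : ∀ σ y, 0 ≤ q σ y := fun σ y => Finset.prod_nonneg fun j _ => hp σ j _
  have single : ∀ i, ∑ σ, δ ^ 2 / 2 * (1 - ∑ j, triDiscr (p σ j) (p (flipAt i σ) j)) ≤
      ∑ σ, ∑ y, q σ y * (t y i - δ * boolSign (σ i)) ^ 2 := by
    intro i
    -- Each vertex is paired with its neighbour across coordinate `i`. Whatever the estimate, the
    -- two squared errors sum to at least `2 δ ^ 2`, and this is paid on the overlap `min` of the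
    -- two laws.
    have sym : ∑ σ, ∑ y, q σ y * (t y i - δ * boolSign (σ i)) ^ 2 =
        ∑ σ, (∑ y, (q σ y * (t y i - δ * boolSign (σ i)) ^ 2 +
          q (flipAt i σ) y * (t y i + δ * boolSign (σ i)) ^ 2)) / 2 := by
      have h := sum_flipAt i fun σ => ∑ y, q σ y * (t y i - δ * boolSign (σ i)) ^ 2
      simp only [flipAt_same, boolSign_not, mul_neg, sub_neg_eq_add] at h
      rw [← Finset.sum_div]
      simp_rw [Finset.sum_add_distrib]
      rw [h]; ring
    rw [sym]
    refine Finset.sum_le_sum fun σ _ => ?_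
    have hmin := sum_min_prod_ge (hp σ) (hp (flipAt i σ)) (hp1 σ) (hp1 (flipAt i σ))
    have hpt : ∀ y, 2 * δ ^ 2 * min (q σ y) (q (flipAt i σ) y) ≤
        q σ y * (t y i - δ * boolSign (σ i)) ^ 2 +
          q (flipAt i σ) y * (t y i + δ * boolSign (σ i)) ^ 2 := by
      intro y
      have hm0 : 0 ≤ min (q σ y) (q (flipAt i σ) y) := le_min (hq0 _ _) (hq0 _ _)
      have e : 2 * δ ^ 2 ≤
          (t y i - δ * boolSign (σ i)) ^ 2 + (t y i + δ * boolSign (σ i)) ^ 2 := by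
        nlinarith [boolSign_sq (σ i), sq_nonneg (t y i)]
      calc _ ≤ min (q σ y) (q (flipAt i σ) y) *
            ((t y i - δ * boolSign (σ i)) ^ 2 + (t y i + δ * boolSign (σ i)) ^ 2) := by
            rw [mul_comm]; gcongr
        _ ≤ _ := by
            rw [mul_add]
            gcongr
            · exact min_le_left _ _
            · exact min_le_right _ _
    have hs := Finset.sum_le_sum fun y (_ : y ∈ Finset.univ) => hpt y
    rw [← Finset.mul_sum] at hs
    have := mul_le_mul_of_nonneg_left hmin (sq_nonneg δ)
    linarith
  calc _ = ∑ i, ∑ σ, δ ^ 2 / 2 * (1 - ∑ j, triDiscr (p σ j) (p (flipAt i σ) j)) := by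
        rw [Finset.sum_comm (s := (Finset.univ : Finset (Fin d)))]
        simp_rw [← Finset.mul_sum]
        congr 1
        simp only [Finset.sum_sub_distrib]
        simp [mul_comm]
    _ ≤ ∑ i, ∑ σ, ∑ y, q σ y * (t y i - δ * boolSign (σ i)) ^ 2 :=
        Finset.sum_le_sum fun i _ => single i
    _ = _ := by
        rw [Finset.sum_comm]
        refine Finset.sum_congr rfl fun σ _ => ?_
        rw [Finset.sum_comm]
        simp_rw [Finset.mul_sum]
        rfl

/-! ### Sub-Gaussian bound for Lipschitz functions -/

lemma integrable_of_abs_le {Ω : Type*} [MeasurableSpace Ω] {μ : Measure Ω} [IsFiniteMeasure μ]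
    {f : Ω → ℝ} (hf : Measurable f) {K : ℝ} (hK : ∀ x, |f x| ≤ K) : Integrable f μ :=
  Integrable.of_bound hf.aestronglyMeasurable K (.of_forall hK)

/-- A bounded Lipschitz function of a Gaussian variable is sub-Gaussian. -/
lemma integral_exp_lipschitz_le (a : ℝ) (v : ℝ≥0) {h : ℝ → ℝ} (hm : Measurable h) {K r : ℝ}
    (hK : ∀ x, |h x| ≤ K) (hr : 0 ≤ r) (hL : ∀ x y, |h x - h y| ≤ r * |x - y|) (l : ℝ) :
    ∫ x, Real.exp (l * (h x - ∫ y, h y ∂gaussianReal a v)) ∂gaussianReal a v ≤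
      Real.exp (l ^ 2 * (r ^ 2 * v)) := by
  set ν := gaussianReal a v
  set κ := ∫ y, h y ∂ν with hκ
  have hint : Integrable h ν := integrable_of_abs_le hm hK
  have hexp : ∀ c : ℝ, Integrable (fun x => Real.exp (c * h x)) ν := fun c => by
    refine integrable_of_abs_le (by fun_prop) (K := Real.exp (|c| * K)) fun x => ?_
    rw [Real.abs_exp, Real.exp_le_exp]
    calc c * h x ≤ |c * h x| := le_abs_self _
      _ = |c| * |h x| := abs_mul _ _
      _ ≤ _ := by gcongr; exact hK x
  -- Symmetrization: the factor with the mean `κ` is replaced by an average over an independent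
  -- copy.
  have jensen : Real.exp (-(l * κ)) ≤ ∫ y, Real.exp (-l * h y) ∂ν := by
    have hpt : ∀ y, Real.exp (-(l * κ)) * (1 + (-l * h y + l * κ)) ≤ Real.exp (-l * h y) := by
      intro y
      have := Real.add_one_le_exp (-l * h y + l * κ)
      calc _ ≤ Real.exp (-(l * κ)) * Real.exp (-l * h y + l * κ) := by gcongr; linarith
        _ = _ := by rw [← Real.exp_add]; congr 1; ring
    have hi : Integrable (fun y => Real.exp (-(l * κ)) * (1 + (-l * h y + l * κ))) ν :=
      ((integrable_const _).add ((hint.const_mul _).add (integrable_const _))).const_mul _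
    have h1 := integral_mono hi (hexp (-l)) hpt
    rw [integral_const_mul, integral_add (f := fun _ => (1 : ℝ))
      (g := fun y => -l * h y + l * κ) (integrable_const _)
      ((hint.const_mul _).add (integrable_const _)),
      integral_add (f := fun y => -l * h y) (g := fun _ => l * κ) (hint.const_mul _)
      (integrable_const _), integral_const_mul, ← hκ] at h1
    simpa using h1
  have e1 : ∫ x, Real.exp (l * (h x - κ)) ∂ν = (∫ x, Real.exp (l * h x) ∂ν) *
      Real.exp (-(l * κ)) := by
    rw [← integral_mul_const]
    congr 1; ext x; rw [← Real.exp_add]; congr 1; ring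
  have hg : ∀ c : ℝ, Integrable (fun x => Real.exp (c * x)) ν := fun c =>
    integrable_exp_mul_gaussianReal c
  have prodexp : ∀ c : ℝ, Integrable (fun z : ℝ × ℝ => Real.exp (c * (h z.1 - h z.2)))
      (ν.prod ν) := fun c => by
    refine ((hexp c).mul_prod (hexp (-c))).congr (.of_forall fun z => ?_)
    simp only; rw [← Real.exp_add]; congr 1; ring
  have prodg : ∀ c : ℝ, Integrable (fun z : ℝ × ℝ => Real.exp (c * (z.1 - z.2)))
      (ν.prod ν) := fun c => by
    refine ((hg c).mul_prod (hg (-c))).congr (.of_forall fun z => ?_)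
    simp only; rw [← Real.exp_add]; congr 1; ring
  have valg : ∀ c : ℝ, ∫ z : ℝ × ℝ, Real.exp (c * (z.1 - z.2)) ∂(ν.prod ν) =
      Real.exp (c ^ 2 * v) := fun c => by
    have m1 : ∀ c : ℝ, ∫ x, Real.exp (c * x) ∂ν = Real.exp (a * c + v * c ^ 2 / 2) := fun c =>
      congrFun (mgf_fun_id_gaussianReal (μ := a) (v := v)) c
    calc _ = ∫ z : ℝ × ℝ, Real.exp (c * z.1) * Real.exp (-c * z.2) ∂(ν.prod ν) := by
          congr 1; ext z; rw [← Real.exp_add]; congr 1; ring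
      _ = _ := by
          rw [integral_prod_mul (fun x => Real.exp (c * x)) fun x => Real.exp (-c * x), m1, m1,
            ← Real.exp_add]
          congr 1; ring
  have swap : ∫ z : ℝ × ℝ, Real.exp (-l * (h z.1 - h z.2)) ∂(ν.prod ν) =
      ∫ z : ℝ × ℝ, Real.exp (l * (h z.1 - h z.2)) ∂(ν.prod ν) := by
    rw [← integral_prod_swap]
    congr 1; ext z; congr 1; simp; ring
  calc _ = (∫ x, Real.exp (l * h x) ∂ν) * Real.exp (-(l * κ)) := e1
    _ ≤ (∫ x, Real.exp (l * h x) ∂ν) * ∫ y, Real.exp (-l * h y) ∂ν := by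
        gcongr
    _ = ∫ z : ℝ × ℝ, Real.exp (l * (h z.1 - h z.2)) ∂(ν.prod ν) := by
        rw [← integral_prod_mul (fun x => Real.exp (l * h x)) fun x => Real.exp (-l * h x)]
        congr 1; ext z; rw [← Real.exp_add]; congr 1; ring
    -- Exchanging the two copies turns `exp` into the even function `cosh`, which is monotone in the
    -- absolute value, so the Lipschitz bound applies. The difference of the two Gaussians has
    -- variance `2 v`.
    _ = ∫ z : ℝ × ℝ, Real.cosh (l * (h z.1 - h z.2)) ∂(ν.prod ν) := by
        simp_rw [Real.cosh_eq, ← neg_mul]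
        rw [integral_div, integral_add (prodexp l) (prodexp (-l)), swap]; ring
    _ ≤ ∫ z : ℝ × ℝ, Real.cosh (l * r * (z.1 - z.2)) ∂(ν.prod ν) := by
        refine integral_mono ?_ ?_ fun z => ?_
        · simp_rw [Real.cosh_eq, ← neg_mul]
          exact ((prodexp l).add (prodexp (-l))).div_const 2
        · simp_rw [Real.cosh_eq, ← neg_mul]
          exact ((prodg (l * r)).add (prodg (-(l * r)))).div_const 2 |>.congr
            (.of_forall fun z => by simp)
        · rw [Real.cosh_le_cosh, abs_mul, abs_mul, abs_mul, abs_of_nonneg hr, mul_assoc]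
          gcongr
          exact hL _ _
    _ = _ := by
        simp_rw [Real.cosh_eq, ← neg_mul (l * r)]
        rw [integral_div, integral_add (prodg _) (prodg _), valg, valg]
        rw [neg_sq, add_self_div_two]; congr 1; ring

/-! ### The clipped likelihood ratio -/

/-- The positive part of `(1 - exp (-2 r u)) / 2`. -/
noncomputable def clip (r u : ℝ) : ℝ := (1 - Real.exp (-(2 * r * max u 0))) / 2

lemma measurable_clip (r : ℝ) : Measurable (clip r) := by unfold clip; fun_prop

lemma clip_nonneg {r : ℝ} (hr : 0 ≤ r) (u : ℝ) : 0 ≤ clip r u := by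
  have : Real.exp (-(2 * r * max u 0)) ≤ 1 := by
    rw [Real.exp_le_one_iff]
    have := le_max_right u 0
    have : 0 ≤ 2 * r * max u 0 := by positivity
    linarith
  unfold clip; linarith

lemma clip_le_half (r u : ℝ) : clip r u ≤ 1 / 2 := by
  have := Real.exp_pos (-(2 * r * max u 0))
  unfold clip; linarith

lemma abs_clip_le {r : ℝ} (hr : 0 ≤ r) (u : ℝ) : |clip r u| ≤ 1 / 2 := by
  rw [abs_of_nonneg (clip_nonneg hr u)]; exact clip_le_half r u

lemma abs_clip_sub_le {r : ℝ} (hr : 0 ≤ r) (u v : ℝ) : |clip r u - clip r v| ≤ r * |u - v| := by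
  have aux : ∀ a b : ℝ, 0 ≤ a → a ≤ b →
      |Real.exp (-(2 * r * b)) - Real.exp (-(2 * r * a))| ≤ 2 * r * (b - a) := by
    intro a b ha hab
    have h1 : Real.exp (-(2 * r * b)) ≤ Real.exp (-(2 * r * a)) := by
      rw [Real.exp_le_exp]; have := mul_le_mul_of_nonneg_left hab hr; linarith
    rw [abs_sub_comm, abs_of_nonneg (by linarith)]
    have h2 := Real.add_one_le_exp (-(2 * r * (b - a)))
    have h3 : Real.exp (-(2 * r * a)) ≤ 1 := by
      rw [Real.exp_le_one_iff]; have := mul_nonneg hr ha; linarith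
    have h4 : Real.exp (-(2 * r * b)) =
        Real.exp (-(2 * r * a)) * Real.exp (-(2 * r * (b - a))) := by
      rw [← Real.exp_add]; congr 1; ring
    have h5 : 0 ≤ 2 * r * (b - a) := by have := sub_nonneg.2 hab; positivity
    rw [h4]
    nlinarith [Real.exp_pos (-(2 * r * a))]
  have key : |Real.exp (-(2 * r * max v 0)) - Real.exp (-(2 * r * max u 0))| ≤
      2 * r * |max u 0 - max v 0| := by
    rcases le_total (max u 0) (max v 0) with h | h
    · rw [abs_sub_comm (max u 0), abs_of_nonneg (sub_nonneg.2 h)]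
      exact aux _ _ (le_max_right _ _) h
    · rw [abs_of_nonneg (sub_nonneg.2 h), abs_sub_comm]
      exact aux _ _ (le_max_right _ _) h
  have e : clip r u - clip r v =
      (Real.exp (-(2 * r * max v 0)) - Real.exp (-(2 * r * max u 0))) / 2 := by
    unfold clip; ring
  rw [e, abs_div, abs_two]
  have := abs_max_sub_max_le_abs u v 0
  have := mul_le_mul_of_nonneg_left this hr
  linarith

lemma clip_le_mul_abs {r : ℝ} (hr : 0 ≤ r) (u : ℝ) : clip r u ≤ r * |u| := by
  have h := abs_clip_sub_le hr u 0
  have h0 : clip r 0 = 0 := by simp [clip]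
  rw [h0, sub_zero, sub_zero] at h
  exact (le_abs_self _).trans h

/-- Flipping a sign sends `u` to `-u` and has likelihood ratio `exp (-2 r u)`. The second term is
exactly the negative part of `(1 - exp (-2 r u)) / 2`, so the two clipped pieces recombine into the
full ratio. -/
lemma clip_sub_clip_neg_mul_exp (r u : ℝ) :
    clip r u - clip r (-u) * Real.exp (-(2 * r * u)) = (1 - Real.exp (-(2 * r * u))) / 2 := by
  unfold clip
  rcases le_total 0 u with h | h
  · rw [max_eq_left h, max_eq_right (neg_nonpos.2 h)]; simp
  · rw [max_eq_right h, max_eq_left (neg_nonneg.2 h)]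
    have : Real.exp (-(2 * r * -u)) * Real.exp (-(2 * r * u)) = 1 := by
      rw [← Real.exp_add]; simp
    simp only [mul_zero, neg_zero, Real.exp_zero]
    linarith

lemma integral_sq_gaussianReal (a : ℝ) (v : ℝ≥0) :
    ∫ x, x ^ 2 ∂gaussianReal a v = a ^ 2 + v := by
  have h := variance_eq_sub (memLp_id_gaussianReal' (μ := a) (v := v) 2 (by simp))
  rw [variance_id_gaussianReal] at h
  simp only [Pi.pow_apply, id_eq, integral_id_gaussianReal] at h
  linarith

lemma integral_clip_sq_le {r : ℝ} (hr : 0 ≤ r) (a : ℝ) (v : ℝ≥0) :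
    ∫ x, clip r x ^ 2 ∂gaussianReal a v ≤ r ^ 2 * (a ^ 2 + v) := by
  rw [← integral_sq_gaussianReal, ← integral_const_mul]
  refine integral_mono ?_ ?_ fun x => ?_
  · refine integrable_of_abs_le ((measurable_clip r).pow_const 2) (K := 1) fun x => ?_
    rw [abs_pow]
    exact pow_le_one₀ (abs_nonneg _) ((abs_clip_le hr x).trans (by norm_num))
  · exact ((memLp_id_gaussianReal' (μ := a) (v := v) 2 (by simp)).integrable_sq).const_mul _
  · calc clip r x ^ 2 ≤ (r * |x|) ^ 2 :=
          pow_le_pow_left₀ (clip_nonneg hr x) (clip_le_mul_abs hr x) 2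
      _ = _ := by rw [mul_pow, sq_abs]

/-! ### Correlation of events with independent variables -/

lemma integral_quadratic {Ω : Type*} [MeasurableSpace Ω] {μ : Measure Ω} [IsFiniteMeasure μ]
    {f : Ω → ℝ} (hf : Integrable f μ) (hf2 : Integrable (fun x => f x ^ 2) μ) (c e : ℝ) :
    ∫ x, (f x ^ 2 - c * f x + e) ∂μ = ∫ x, f x ^ 2 ∂μ - c * ∫ x, f x ∂μ + μ.real Set.univ * e := by
  rw [integral_add (f := fun x => f x ^ 2 - c * f x) (g := fun _ => e)
    (hf2.sub (hf.const_mul _)) (integrable_const _),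
    integral_sub (f := fun x => f x ^ 2) hf2 (hf.const_mul _), integral_const_mul]
  simp

section Correlation

variable {Ω : Type*} [MeasurableSpace Ω] {μ : Measure Ω} [IsProbabilityMeasure μ]

lemma integral_sub_sq_eq {f : Ω → ℝ} (hf : Integrable f μ) (hf2 : Integrable (fun x => f x ^ 2) μ)
    (c : ℝ) :
    ∫ x, (f x - c) ^ 2 ∂μ = ∫ x, f x ^ 2 ∂μ - 2 * c * ∫ x, f x ∂μ + c ^ 2 := by
  have e : ∀ x, (f x - c) ^ 2 = f x ^ 2 - 2 * c * f x + c ^ 2 := fun x => by ring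
  simp_rw [e]
  rw [integral_quadratic hf hf2]
  simp

/-- Correlations of an event with independent sub-Gaussian variables. -/
lemma sum_sq_setIntegral_div_le {ι : Type*} [Fintype ι] {g : ι → Ω → ℝ}
    (hg : ∀ i, Measurable (g i)) {b : ℝ} (hb : ∀ i x, |g i x| ≤ b) (hind : iIndepFun g μ)
    {K : ℝ} (hK : 0 < K) (hmgf : ∀ i l, ∫ x, Real.exp (l * g i x) ∂μ ≤ Real.exp (l ^ 2 * K))
    {A : Set Ω} :
    ∑ i, (∫ x in A, g i x ∂μ) ^ 2 / μ.real A ≤ 4 * K * Real.negMulLog (μ.real A) := by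
  rcases (measureReal_nonneg (μ := μ) (s := A)).eq_or_lt with h0 | hpos
  · simp [← h0]
  set p := μ.real A with hp
  set G : ι → ℝ := fun i => ∫ x in A, g i x ∂μ with hG
  set W : ℝ := ∑ i, G i ^ 2 / p ^ 2 with hW
  -- These weights maximize `∑ (a i * G i / p - K * a i ^ 2)`, the conditional mean of `S` given `A`
  -- minus the bound on its log moment generating function.
  set a : ι → ℝ := fun i => G i / p / (2 * K) with ha
  have hgi : ∀ i, Integrable (g i) μ := fun i => integrable_of_abs_le (hg i) (hb i)
  set S : Ω → ℝ := fun x => ∑ i, a i * g i x with hS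
  have hSi : Integrable S μ := integrable_finsetSum _ fun i _ => (hgi i).const_mul _
  have hSm : Measurable S := Finset.measurable_sum _ fun i _ => (hg i).const_mul _
  have hexpi : Integrable (fun x => Real.exp (S x)) μ := by
    refine integrable_of_abs_le (by fun_prop) (K := Real.exp (∑ i, |a i| * b)) fun x => ?_
    rw [Real.abs_exp, Real.exp_le_exp]
    refine Finset.sum_le_sum fun i _ => (le_abs_self _).trans ?_
    rw [abs_mul]
    gcongr
    exact hb i x
  have hprod : ∫ x, Real.exp (S x) ∂μ ≤ Real.exp (W / (4 * K)) := by
    have h1 : ∫ x, Real.exp (S x) ∂μ = ∏ i, ∫ x, Real.exp (a i * g i x) ∂μ := by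
      have hi : iIndepFun (fun i x => Real.exp (a i * g i x)) μ :=
        hind.comp (fun i y => Real.exp (a i * y)) fun i => by fun_prop
      rw [← hi.integral_fun_prod_eq_prod_integral
        fun i => by have := hg i; exact Measurable.aestronglyMeasurable (by fun_prop)]
      simp_rw [hS, Real.exp_sum]
    rw [h1]
    calc _ ≤ ∏ i, Real.exp (a i ^ 2 * K) :=
          Finset.prod_le_prod (fun i _ => integral_nonneg fun _ => (Real.exp_pos _).le)
            fun i _ => hmgf i (a i)
      _ = _ := by
          rw [← Real.exp_sum]
          congr 1
          rw [hW, Finset.sum_div]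
          refine Finset.sum_congr rfl fun i _ => ?_
          simp only [ha]; field_simp; ring
  have hSA : ∫ x in A, S x ∂μ = p * (W / (2 * K)) := by
    rw [hS, integral_finsetSum _ fun i _ => ((hgi i).const_mul _).integrableOn, hW,
      Finset.sum_div, Finset.mul_sum]
    refine Finset.sum_congr rfl fun i _ => ?_
    rw [integral_const_mul]
    simp only [ha, hG]; field_simp
  -- Jensen on `A`, by the tangent to `exp` at `W / (2 K)`, the conditional mean of `S` given `A`.
  have htan : Real.exp (W / (2 * K)) * p ≤ ∫ x, Real.exp (S x) ∂μ := by
    set c := W / (2 * K)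
    calc _ = ∫ x in A, Real.exp c * (1 - c + S x) ∂μ := by
          rw [integral_const_mul, integral_add (integrable_const _) hSi.integrableOn, hSA,
            setIntegral_const, smul_eq_mul, ← hp]
          ring
      _ ≤ ∫ x in A, Real.exp (S x) ∂μ := by
          refine integral_mono (((integrable_const _).add hSi.integrableOn).const_mul _)
            hexpi.integrableOn fun x => ?_
          have := Real.add_one_le_exp (S x - c)
          calc Real.exp c * (1 - c + S x) ≤ Real.exp c * Real.exp (S x - c) := by
                gcongr; linarith
            _ = _ := by rw [← Real.exp_add]; congr 1; ring
      _ ≤ _ := setIntegral_le_integral hexpi (.of_forall fun x => (Real.exp_pos _).le)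
  have hlog : W / (2 * K) + Real.log p ≤ W / (4 * K) := by
    rw [← Real.exp_le_exp, Real.exp_add, Real.exp_log hpos]
    exact htan.trans hprod
  have hWle : W ≤ 4 * K * -Real.log p := by
    have e : W / (2 * K) = 2 * (W / (4 * K)) := by field_simp; ring
    have : W / (4 * K) ≤ -Real.log p := by linarith
    rwa [div_le_iff₀ (by positivity), mul_comm] at this
  have e : ∑ i, G i ^ 2 / p = p * W := by
    rw [hW, Finset.mul_sum]
    refine Finset.sum_congr rfl fun i _ => ?_
    field_simp
  rw [e, Real.negMulLog]
  calc p * W ≤ p * (4 * K * -Real.log p) := by gcongr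
    _ = _ := by ring

/-- Cauchy–Schwarz on `A`, from the nonnegative integral of the squared deviation from the
conditional mean `G / p`. -/
lemma sq_setIntegral_div_le {g : Ω → ℝ} (hg : Measurable g) {b : ℝ} (hb : ∀ x, |g x| ≤ b)
    {A : Set Ω} : (∫ x in A, g x ∂μ) ^ 2 / μ.real A ≤ ∫ x in A, g x ^ 2 ∂μ := by
  rcases (measureReal_nonneg (μ := μ) (s := A)).eq_or_lt with h0 | hpos
  · rw [← h0, div_zero]; exact integral_nonneg fun _ => sq_nonneg _
  have hi : IntegrableOn g A μ := (integrable_of_abs_le hg hb).integrableOn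
  have hi2 : IntegrableOn (fun x => g x ^ 2) A μ := by
    refine (integrable_of_abs_le (hg.pow_const 2) (K := b ^ 2) fun x => ?_).integrableOn
    rw [abs_pow]; exact pow_le_pow_left₀ (abs_nonneg _) (hb x) 2
  set G := ∫ x in A, g x ∂μ with hG
  set p := μ.real A with hp
  have h : 0 ≤ ∫ x in A, (g x ^ 2 - 2 * (G / p) * g x + (G / p) ^ 2) ∂μ :=
    integral_nonneg fun x => by
      have := sq_nonneg (g x - G / p)
      simp only [Pi.zero_apply]; nlinarith
  rw [integral_quadratic hi hi2, measureReal_restrict_apply_univ, ← hG, ← hp] at h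
  have e : 2 * (G / p) * G = 2 * (G ^ 2 / p) := by ring
  have e2 : p * (G / p) ^ 2 = G ^ 2 / p := by field_simp
  linarith

lemma sum_measureReal_preimage {Y : Type*} [Fintype Y] [MeasurableSpace Y]
    [MeasurableSingletonClass Y] {f : Ω → Y} (hf : Measurable f) :
    ∑ y, μ.real (f ⁻¹' {y}) = 1 := by
  have h := sum_measureReal_preimage_singleton (μ := μ) (f := f) (Finset.univ : Finset Y)
    fun y _ => hf (measurableSet_singleton y)
  rw [h]; simp

/-- The left side is the squared norm of the conditional expectation of `g` given `f`, and
conditioning contracts `L²`. -/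
lemma sum_sq_setIntegral_preimage_div_le {Y : Type*} [Fintype Y] [MeasurableSpace Y]
    [MeasurableSingletonClass Y] {f : Ω → Y} (hf : Measurable f) {g : Ω → ℝ} (hg : Measurable g)
    {b : ℝ} (hb : ∀ x, |g x| ≤ b) :
    ∑ y, (∫ x in f ⁻¹' {y}, g x ∂μ) ^ 2 / μ.real (f ⁻¹' {y}) ≤ ∫ x, g x ^ 2 ∂μ := by
  have hi2 : Integrable (fun x => g x ^ 2) μ := by
    refine integrable_of_abs_le (hg.pow_const 2) (K := b ^ 2) fun x => ?_
    rw [abs_pow]; exact pow_le_pow_left₀ (abs_nonneg _) (hb x) 2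
  calc _ ≤ ∑ y, ∫ x in f ⁻¹' {y}, g x ^ 2 ∂μ :=
        Finset.sum_le_sum fun y _ => sq_setIntegral_div_le hg hb
    _ = ∫ x in ⋃ y, f ⁻¹' {y}, g x ^ 2 ∂μ := by
        rw [integral_iUnion_fintype (fun y => hf (measurableSet_singleton y)) _
          fun y => hi2.integrableOn]
        intro y z hyz
        exact Disjoint.preimage f (by simpa using hyz)
    _ = _ := by
        have : (⋃ y, f ⁻¹' {y}) = Set.univ := by
          ext x; simp
        rw [this, setIntegral_univ]

end Correlation

/-- The uniform law maximizes entropy: `log x ≤ x - 1` at `x = 1 / (p y * M)`. -/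
lemma sum_negMulLog_le {Y : Type*} [Fintype Y] [Nonempty Y] {p : Y → ℝ} (hp : ∀ y, 0 ≤ p y)
    (hp1 : ∑ y, p y = 1) : ∑ y, Real.negMulLog (p y) ≤ Real.log (Fintype.card Y) := by
  have hM : (0 : ℝ) < (Fintype.card Y : ℕ) := by positivity
  set M : ℝ := ((Fintype.card Y : ℕ) : ℝ) with hMdef
  have h : ∀ y, Real.negMulLog (p y) ≤ p y * Real.log M + (M⁻¹ - p y) := by
    intro y
    rcases (hp y).eq_or_lt with h0 | h0
    · simp only [← h0, Real.negMulLog_zero]; simp [hM.le]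
    · have := Real.log_le_sub_one_of_pos (x := (p y * M)⁻¹) (by positivity)
      rw [Real.log_inv, Real.log_mul h0.ne' hM.ne'] at this
      have h2 := mul_le_mul_of_nonneg_left this h0.le
      have e : p y * ((p y * M)⁻¹ - 1) = M⁻¹ - p y := by field_simp
      rw [e] at h2
      rw [Real.negMulLog]; linarith
  calc _ ≤ ∑ y, (p y * Real.log M + (M⁻¹ - p y)) := Finset.sum_le_sum fun y _ => h y
    _ = _ := by
        rw [Finset.sum_add_distrib, Finset.sum_sub_distrib, ← Finset.sum_mul, hp1]
        simp [← hMdef, hM.ne']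

/-! ### Change of measure along one coordinate -/

/-- Changing one factor of an infinite product by a density. -/
lemma infinitePi_eq_withDensity {ι : Type*} [DecidableEq ι] {X : ι → Type*}
    [∀ k, MeasurableSpace (X k)] {μ μ' : ∀ k, Measure (X k)}
    [∀ k, IsProbabilityMeasure (μ k)] [∀ k, IsProbabilityMeasure (μ' k)] (i : ι)
    {ρ : X i → ℝ≥0∞} (hρ : Measurable ρ) (hi : μ' i = (μ i).withDensity ρ)
    (hne : ∀ k, k ≠ i → μ' k = μ k) :
    Measure.infinitePi μ' = (Measure.infinitePi μ).withDensity fun x => ρ (x i) := by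
  refine (Measure.eq_infinitePi (μ := μ') fun s t ht => ?_).symm
  have hms : MeasurableSet (Set.pi (s : Set ι) t) :=
    MeasurableSet.pi s.countable_toSet fun k _ => ht k
  rw [withDensity_apply _ hms, ← lintegral_indicator hms]
  let T : ∀ k, Set (X k) := fun k => if k ∈ s then t k else Set.univ
  have hT : ∀ k, MeasurableSet (T k) := fun k => by
    by_cases h : k ∈ s <;> simp [T, h, ht k]
  let D : ∀ k, X k → ℝ≥0∞ := Function.update (fun _ _ => 1) i ρ
  have hDi : D i = ρ := by simp [D]
  have hDne : ∀ k, k ≠ i → D k = fun _ => 1 := fun k hk => by simp [D, hk]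
  have hD : ∀ k, Measurable (D k) := fun k => by
    by_cases h : k = i
    · subst h; rw [hDi]; exact hρ
    · rw [hDne k h]; exact measurable_const
  let F : ∀ k, X k → ℝ≥0∞ := fun k => (T k).indicator (D k)
  have hF : ∀ k, Measurable (F k) := fun k => (hD k).indicator (hT k)
  have hμ' : ∀ k, μ' k = (μ k).withDensity (D k) := fun k => by
    by_cases h : k = i
    · subst h; rw [hDi, hi]
    · rw [hDne k h, hne k h]; exact (withDensity_one).symm
  have hval : ∀ k, ∫⁻ x, F k (x k) ∂Measure.infinitePi μ = μ' k (T k) := fun k => by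
    rw [(measurePreserving_eval_infinitePi μ k).lintegral_comp (hF k),
      lintegral_indicator (hT k), hμ', withDensity_apply _ (hT k)]
  -- The box need not constrain coordinate `i`, so `i` is inserted with `T i = univ`; the integrand
  -- is then a finite product of functions of independent coordinates.
  have hpt : ∀ x : ∀ k, X k, (Set.pi (s : Set ι) t).indicator (fun x => ρ (x i)) x =
      ∏ k ∈ insert i s, F k (x k) := fun x => by
    by_cases hx : x ∈ Set.pi (s : Set ι) t
    · have hxT : ∀ k, x k ∈ T k := fun k => by
        by_cases h : k ∈ s
        · simpa [T, h] using hx k h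
        · simp [T, h]
      rw [Set.indicator_of_mem hx, Finset.prod_eq_single i]
      · simp [F, Set.indicator_of_mem (hxT i), hDi]
      · intro k _ hk
        simp [F, Set.indicator_of_mem (hxT k), hDne k hk]
      · simp
    · rw [Set.indicator_of_notMem hx]
      simp only [Set.mem_pi, not_forall] at hx
      obtain ⟨k, hk, hxk⟩ := hx
      refine (Finset.prod_eq_zero (i := k) (Finset.mem_insert_of_mem hk) ?_).symm
      have : x k ∉ T k := by simpa [T, Finset.mem_coe.1 hk] using hxk
      simp [F, this]
  simp_rw [hpt]
  have hind : iIndepFun (fun k (x : ∀ k, X k) => F k (x k)) (Measure.infinitePi μ) :=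
    iIndepFun_infinitePi hF
  rw [lintegral_prod_eq_prod_lintegral_of_indepFun _ _ hind
    fun k => (hF k).comp (measurable_pi_apply k)]
  simp_rw [hval]
  have hTs : ∀ k ∈ s, μ' k (T k) = μ' k (t k) := fun k hk => by simp [T, hk]
  by_cases his : i ∈ s
  · rw [Finset.insert_eq_of_mem his]; exact Finset.prod_congr rfl hTs
  · rw [Finset.prod_insert his, Finset.prod_congr rfl hTs]; simp [T, his]

lemma gaussianReal_neg_eq_withDensity (a : ℝ) {v : ℝ≥0} (hv : v ≠ 0) :
    gaussianReal (-a) v =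
      (gaussianReal a v).withDensity fun x => ENNReal.ofReal (Real.exp (-(2 * a * x / v))) := by
  rw [gaussianReal_of_var_ne_zero _ hv, gaussianReal_of_var_ne_zero _ hv,
    ← withDensity_mul _ (measurable_gaussianPDF _ _) (by fun_prop)]
  congr 1
  ext x
  simp only [Pi.mul_apply, gaussianPDF, gaussianPDFReal]
  rw [← ENNReal.ofReal_mul (by positivity), mul_assoc (_)⁻¹ (Real.exp _) (Real.exp _),
    ← Real.exp_add]
  congr 3
  have : (v : ℝ) ≠ 0 := by exact_mod_cast hv
  field_simp
  ring

/-! ### Gaussian observations at the vertices of the cube -/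

instance (n : ℕ) (θ : ℕ → ℝ) : IsProbabilityMeasure (obsLaw n θ) := by
  unfold obsLaw; infer_instance

/-- The vertex of the cube `{-δ, δ} ^ d` given by `σ`, as a sequence supported on `[0, d)`. -/
noncomputable def cubeMean {d : ℕ} (δ : ℝ) (σ : Fin d → Bool) (k : ℕ) : ℝ :=
  if h : k < d then δ * boolSign (σ ⟨k, h⟩) else 0

lemma cubeMean_fin {d : ℕ} (δ : ℝ) (σ : Fin d → Bool) (i : Fin d) :
    cubeMean δ σ i = δ * boolSign (σ i) := by simp [cubeMean]

lemma cubeMean_flipAt_same {d : ℕ} (δ : ℝ) (σ : Fin d → Bool) (i : Fin d) :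
    cubeMean δ (flipAt i σ) i = -cubeMean δ σ i := by
  rw [cubeMean_fin, cubeMean_fin, flipAt_same, boolSign_not]; ring

lemma cubeMean_flipAt_of_ne {d : ℕ} (δ : ℝ) (σ : Fin d → Bool) (i : Fin d) {k : ℕ}
    (h : k ≠ i) : cubeMean δ (flipAt i σ) k = cubeMean δ σ k := by
  unfold cubeMean
  split_ifs with hk
  · rw [flipAt_of_ne (by rintro rfl; exact h rfl)]
  · rfl

lemma obsLaw_flipAt {d n : ℕ} (hn : 0 < n) (δ : ℝ) (σ : Fin d → Bool) (i : Fin d) :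
    obsLaw n (cubeMean δ (flipAt i σ)) = (obsLaw n (cubeMean δ σ)).withDensity fun x =>
      ENNReal.ofReal (Real.exp (-(2 * (n * δ) * (boolSign (σ i) * x i)))) := by
  have hv : (1 / (n : ℝ≥0)) ≠ 0 := by positivity
  have hρ : Measurable fun y : ℝ =>
      ENNReal.ofReal (Real.exp (-(2 * (n * δ) * (boolSign (σ i) * y)))) := by fun_prop
  have h1 : gaussianReal (cubeMean δ (flipAt i σ) i) (1 / (n : ℝ≥0)) =
      (gaussianReal (cubeMean δ σ i) (1 / (n : ℝ≥0))).withDensity fun y : ℝ =>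
      ENNReal.ofReal (Real.exp (-(2 * (n * δ) * (boolSign (σ i) * y)))) := by
    rw [cubeMean_flipAt_same, gaussianReal_neg_eq_withDensity _ hv, cubeMean_fin]
    have hn' : (n : ℝ) ≠ 0 := by positivity
    have e : ∀ x : ℝ, 2 * (δ * boolSign (σ i)) * x / ((1 / (n : ℝ≥0) : ℝ≥0) : ℝ) =
      2 * (n * δ) * (boolSign (σ i) * x) := fun x => by
      push_cast
      field_simp
    simp_rw [e]
  have key := infinitePi_eq_withDensity (X := fun _ : ℕ => ℝ)
    (μ := fun k => gaussianReal (cubeMean δ σ k) (1 / (n : ℝ≥0)))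
    (μ' := fun k => gaussianReal (cubeMean δ (flipAt i σ) k) (1 / (n : ℝ≥0))) (i : ℕ)
    hρ h1 fun k hk => by rw [cubeMean_flipAt_of_ne δ σ i hk]
  unfold obsLaw
  exact key

lemma map_boolSign_mul_obsLaw {d n : ℕ} (δ : ℝ) (σ : Fin d → Bool) (i : Fin d) :
    (obsLaw n (cubeMean δ σ)).map (fun x => boolSign (σ i) * x i) =
      gaussianReal δ (1 / (n : ℝ≥0)) := by
  have h : (obsLaw n (cubeMean δ σ)).map (fun x => x (i : ℕ)) =
      gaussianReal (cubeMean δ σ i) (1 / (n : ℝ≥0)) := Measure.infinitePi_map_eval _ _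
  have e : (fun x : ℕ → ℝ => boolSign (σ i) * x i) =
      (fun y => boolSign (σ i) * y) ∘ fun x => x (i : ℕ) := rfl
  rw [e, ← Measure.map_map (by fun_prop) (by fun_prop), h, gaussianReal_map_const_mul,
    cubeMean_fin]
  congr 1
  · have := boolSign_sq (σ i)
    calc _ = δ * boolSign (σ i) ^ 2 := by ring
      _ = δ := by rw [this, mul_one]
  · have : NNReal.mk (boolSign (σ i) ^ 2) (sq_nonneg _) = 1 := by
      ext; exact boolSign_sq (σ i)
    rw [this, one_mul]

lemma integral_boolSign_mul_obsLaw {d n : ℕ} (δ : ℝ) (σ : Fin d → Bool) (i : Fin d) {f : ℝ → ℝ}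
    (hf : Measurable f) :
    ∫ x, f (boolSign (σ i) * x i) ∂obsLaw n (cubeMean δ σ) =
      ∫ y, f y ∂gaussianReal δ (1 / (n : ℝ≥0)) := by
  rw [← map_boolSign_mul_obsLaw δ σ i, integral_map
    ((measurable_pi_apply _).const_mul _).aemeasurable hf.aestronglyMeasurable]

/-- The mean of `clip (n δ)` under `N(δ, 1 / n)`. -/
noncomputable def clipMean (n : ℕ) (δ : ℝ) : ℝ :=
  ∫ y, clip (n * δ) y ∂gaussianReal δ (1 / (n : ℝ≥0))

lemma integral_clip_sq_le_two_mul {n : ℕ} (hn : 0 < n) {δ : ℝ} (hδ : 0 ≤ δ)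
    (hnδ : n * δ ^ 2 ≤ 1) :
    ∫ y, clip (n * δ) y ^ 2 ∂gaussianReal δ (1 / (n : ℝ≥0)) ≤ 2 * (n * δ ^ 2) := by
  refine (integral_clip_sq_le (by positivity) δ _).trans ?_
  have hn' : (0 : ℝ) < n := by positivity
  have e : (n * δ) ^ 2 * (δ ^ 2 + ((1 / (n : ℝ≥0) : ℝ≥0) : ℝ)) =
      n * δ ^ 2 * (n * δ ^ 2 + 1) := by
    push_cast; field_simp
  rw [e]
  have : 0 ≤ n * δ ^ 2 := by positivity
  nlinarith

lemma integrable_clip {ν : Measure ℝ} [IsFiniteMeasure ν] {r : ℝ} (hr : 0 ≤ r) :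
    Integrable (clip r) ν := integrable_of_abs_le (measurable_clip r) (abs_clip_le hr)

lemma integrable_clip_sq {ν : Measure ℝ} [IsFiniteMeasure ν] {r : ℝ} (hr : 0 ≤ r) :
    Integrable (fun x => clip r x ^ 2) ν := by
  refine integrable_of_abs_le ((measurable_clip r).pow_const 2) (K := 1) fun x => ?_
  rw [abs_pow]
  exact pow_le_one₀ (abs_nonneg _) ((abs_clip_le hr x).trans (by norm_num))

lemma integral_clip_sub_sq {n : ℕ} {δ : ℝ} (hδ : 0 ≤ δ) :
    ∫ y, (clip (n * δ) y - clipMean n δ) ^ 2 ∂gaussianReal δ (1 / (n : ℝ≥0)) =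
      ∫ y, clip (n * δ) y ^ 2 ∂gaussianReal δ (1 / (n : ℝ≥0)) - clipMean n δ ^ 2 := by
  rw [integral_sub_sq_eq (integrable_clip (by positivity)) (integrable_clip_sq (by positivity))]
  unfold clipMean; ring

lemma clipMean_nonneg (n : ℕ) {δ : ℝ} (hδ : 0 ≤ δ) : 0 ≤ clipMean n δ :=
  integral_nonneg fun _ => clip_nonneg (by positivity) _

/-- The squared mean is at most the second moment, hence at most `2 n δ ^ 2 ≤ 1 / 16`. This is the
source of the threshold `1 / 32`; it keeps the mean away from `1 / 2`. -/
lemma clipMean_le {n : ℕ} (hn : 0 < n) {δ : ℝ} (hδ : 0 ≤ δ) (hnδ : n * δ ^ 2 ≤ 1 / 32) :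
    clipMean n δ ≤ 1 / 4 := by
  have h1 := integral_clip_sub_sq (n := n) hδ
  have h2 := integral_clip_sq_le_two_mul hn hδ (hnδ.trans (by norm_num))
  have h3 : 0 ≤ ∫ y, (clip (n * δ) y - clipMean n δ) ^ 2 ∂gaussianReal δ (1 / (n : ℝ≥0)) :=
    integral_nonneg fun _ => sq_nonneg _
  nlinarith

/-! ### Scores and the information in a message -/

/-- The centred, clipped likelihood ratio of coordinate `i`. -/
noncomputable def score (n : ℕ) {d : ℕ} (δ : ℝ) (σ : Fin d → Bool) (i : Fin d) (x : ℕ → ℝ) : ℝ :=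
  clip (n * δ) (boolSign (σ i) * x i) - clipMean n δ

lemma measurable_score (n : ℕ) {d : ℕ} (δ : ℝ) (σ : Fin d → Bool) (i : Fin d) :
    Measurable (score n δ σ i) :=
  ((measurable_clip _).comp
    (by fun_prop : Measurable fun x : ℕ → ℝ => boolSign (σ i) * x i)).sub_const _

lemma abs_score_le (n : ℕ) {d : ℕ} {δ : ℝ} (hδ : 0 ≤ δ) (σ : Fin d → Bool) (i : Fin d)
    (x : ℕ → ℝ) : |score n δ σ i x| ≤ 1 / 2 + clipMean n δ := by
  refine (abs_sub _ _).trans (add_le_add (abs_clip_le (by positivity) _) ?_)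
  rw [abs_of_nonneg (clipMean_nonneg n hδ)]

lemma iIndepFun_score (n : ℕ) {d : ℕ} (δ : ℝ) (σ : Fin d → Bool) :
    iIndepFun (fun i => score n δ σ i) (obsLaw n (cubeMean δ σ)) := by
  have h : iIndepFun (fun (k : ℕ) (x : ℕ → ℝ) => x k) (obsLaw n (cubeMean δ σ)) :=
    iIndepFun_infinitePi (X := fun _ y => y) fun _ => measurable_id
  have h2 := h.precomp (g := fun i : Fin d => (i : ℕ)) Fin.val_injective
  exact h2.comp (fun i y => clip (n * δ) (boolSign (σ i) * y) - clipMean n δ) fun i =>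
    ((measurable_clip _).comp (by fun_prop)).sub_const _

lemma integral_exp_score_le {n : ℕ} (hn : 0 < n) {d : ℕ} {δ : ℝ} (hδ : 0 ≤ δ)
    (σ : Fin d → Bool) (i : Fin d) (l : ℝ) :
    ∫ x, Real.exp (l * score n δ σ i x) ∂obsLaw n (cubeMean δ σ) ≤
      Real.exp (l ^ 2 * (n * δ ^ 2)) := by
  have hr : 0 ≤ n * δ := by positivity
  have h := integral_exp_lipschitz_le δ (1 / (n : ℝ≥0)) (measurable_clip (n * δ))
    (abs_clip_le hr) hr (abs_clip_sub_le hr) l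
  have hm := measurable_clip (n * δ)
  unfold score
  rw [integral_boolSign_mul_obsLaw δ σ i
    (f := fun y => Real.exp (l * (clip (n * δ) y - clipMean n δ))) (by fun_prop)]
  refine h.trans_eq ?_
  congr 2
  have hn' : (0 : ℝ) < n := by positivity
  push_cast; field_simp

lemma integral_score_sq_le {n : ℕ} (hn : 0 < n) {d : ℕ} {δ : ℝ} (hδ : 0 ≤ δ)
    (hnδ : n * δ ^ 2 ≤ 1) (σ : Fin d → Bool) (i : Fin d) :
    ∫ x, score n δ σ i x ^ 2 ∂obsLaw n (cubeMean δ σ) ≤ 2 * (n * δ ^ 2) := by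
  have hm := measurable_clip (n * δ)
  unfold score
  rw [integral_boolSign_mul_obsLaw δ σ i
    (f := fun y => (clip (n * δ) y - clipMean n δ) ^ 2) (by fun_prop), integral_clip_sub_sq hδ]
  have := integral_clip_sq_le_two_mul hn hδ hnδ
  have := sq_nonneg (clipMean n δ)
  linarith

/-- Writing the flipped law as a density against the original one reduces this to the pointwise
identity `clip_sub_clip_neg_mul_exp`. -/
lemma setIntegral_clip_sub {d n : ℕ} (hn : 0 < n) {δ : ℝ} (hδ : 0 ≤ δ) (σ : Fin d → Bool)
    (i : Fin d) {A : Set (ℕ → ℝ)} (hA : MeasurableSet A) :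
    ∫ x in A, clip (n * δ) (boolSign (σ i) * x i) ∂obsLaw n (cubeMean δ σ) -
      ∫ x in A, clip (n * δ) (boolSign (flipAt i σ i) * x i) ∂obsLaw n (cubeMean δ (flipAt i σ)) =
    ((obsLaw n (cubeMean δ σ)).real A - (obsLaw n (cubeMean δ (flipAt i σ))).real A) / 2 := by
  have hr : 0 ≤ n * δ := by positivity
  have hm := measurable_clip (n * δ)
  set μ := obsLaw n (cubeMean δ σ) with hμ
  set D : (ℕ → ℝ) → ℝ := fun x => Real.exp (-(2 * (n * δ) * (boolSign (σ i) * x i))) with hD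
  have hDm : Measurable D := by fun_prop
  have hμ' : obsLaw n (cubeMean δ (flipAt i σ)) = μ.withDensity fun x => ENNReal.ofReal (D x) :=
    obsLaw_flipAt hn δ σ i
  have hDi : Integrable D μ := by
    refine ⟨hDm.aestronglyMeasurable, ?_⟩
    rw [hasFiniteIntegral_iff_ofReal (.of_forall fun x => (Real.exp_pos _).le)]
    have h1 : (μ.withDensity fun x => ENNReal.ofReal (D x)) Set.univ = 1 := by
      rw [← hμ']; exact measure_univ
    rw [withDensity_apply _ MeasurableSet.univ, Measure.restrict_univ] at h1
    rw [h1]; exact ENNReal.one_lt_top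
  have change : ∀ f : (ℕ → ℝ) → ℝ, ∫ x in A, f x ∂obsLaw n (cubeMean δ (flipAt i σ)) =
      ∫ x in A, f x * D x ∂μ := fun f => by
    rw [hμ', setIntegral_withDensity_eq_setIntegral_toReal_smul₀ (by fun_prop)
      (.of_forall fun x => ENNReal.ofReal_lt_top) _ hA]
    refine integral_congr_ae (.of_forall fun x => ?_)
    simp only
    rw [ENNReal.toReal_ofReal (Real.exp_pos _).le, smul_eq_mul, mul_comm]
  have hreal : (obsLaw n (cubeMean δ (flipAt i σ))).real A = ∫ x in A, D x ∂μ := by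
    have := change fun _ => 1
    simpa using this
  have hreal' : μ.real A = ∫ _x in A, (1 : ℝ) ∂μ := by simp
  have hc : ∀ s : ℝ, Measurable fun x : ℕ → ℝ => clip (n * δ) (s * x i) := fun s => by fun_prop
  have i1 : Integrable (fun x : ℕ → ℝ => clip (n * δ) (boolSign (σ i) * x i)) μ :=
    integrable_of_abs_le (hc _) fun x => abs_clip_le hr _
  have i2 : Integrable (fun x : ℕ → ℝ => clip (n * δ) (boolSign (flipAt i σ i) * x i) * D x) μ :=
    hDi.bdd_mul (hc _).aestronglyMeasurable (.of_forall fun x => abs_clip_le hr _)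
  rw [change, hreal, hreal', ← integral_sub i1.integrableOn i2.integrableOn,
    ← integral_sub (integrable_const _) hDi.integrableOn, ← integral_div]
  refine integral_congr_ae (.of_forall fun x => ?_)
  have := clip_sub_clip_neg_mul_exp (n * δ) (boolSign (σ i) * x i)
  simp only [flipAt_same, boolSign_not, neg_mul]
  exact this

/-- Information that the event `A` carries about coordinate `i`. -/
noncomputable def corr (n : ℕ) {d : ℕ} (δ : ℝ) (σ : Fin d → Bool) (i : Fin d)
    (A : Set (ℕ → ℝ)) : ℝ :=
  (∫ x in A, score n δ σ i x ∂obsLaw n (cubeMean δ σ)) ^ 2 / (obsLaw n (cubeMean δ σ)).real A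

/-- Centring `setIntegral_clip_sub` gives `(1/2 - κ) (p - q) = G - G'`. Since `κ ≤ 1/4`, squaring
costs `16`, and `(G - G') ^ 2 ≤ 2 (G ^ 2 + G' ^ 2)` costs another `2`. -/
lemma sq_sub_div_add_le_corr {d n : ℕ} (hn : 0 < n) {δ : ℝ} (hδ : 0 ≤ δ)
    (hnδ : n * δ ^ 2 ≤ 1 / 32) (σ : Fin d → Bool) (i : Fin d) {A : Set (ℕ → ℝ)}
    (hA : MeasurableSet A) :
    ((obsLaw n (cubeMean δ σ)).real A - (obsLaw n (cubeMean δ (flipAt i σ))).real A) ^ 2 /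
      ((obsLaw n (cubeMean δ σ)).real A + (obsLaw n (cubeMean δ (flipAt i σ))).real A) ≤
    32 * (corr n δ σ i A + corr n δ (flipAt i σ) i A) := by
  have hr : 0 ≤ n * δ := by positivity
  have hid := setIntegral_clip_sub hn hδ σ i hA
  have hm := measurable_clip (n * δ)
  have hG : ∀ τ : Fin d → Bool, ∫ x in A, score n δ τ i x ∂obsLaw n (cubeMean δ τ) =
      ∫ x in A, clip (n * δ) (boolSign (τ i) * x i) ∂obsLaw n (cubeMean δ τ) -
        (obsLaw n (cubeMean δ τ)).real A * clipMean n δ := fun τ => by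
    unfold score
    rw [integral_sub _ (integrable_const _), setIntegral_const, smul_eq_mul]
    exact (integrable_of_abs_le (by fun_prop) fun x => abs_clip_le hr _).integrableOn
  have hκ0 := clipMean_nonneg n hδ
  have hκ1 := clipMean_le hn hδ hnδ
  -- On a null event the integral vanishes too, so the convention `x / 0 = 0` in `corr` loses
  -- nothing.
  have hz : ∀ τ : Fin d → Bool, (obsLaw n (cubeMean δ τ)).real A = 0 →
      ∫ x in A, score n δ τ i x ∂obsLaw n (cubeMean δ τ) = 0 := fun τ h => by
    rw [Measure.restrict_eq_zero.2 ((measureReal_eq_zero_iff (by simp)).1 h),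
      integral_zero_measure]
  unfold corr
  rw [← sub_eq_zero] at hid
  have h1 := hG σ
  have h2 := hG (flipAt i σ)
  have z1 := hz σ
  have z2 := hz (flipAt i σ)
  have hp0 : 0 ≤ (obsLaw n (cubeMean δ σ)).real A := measureReal_nonneg
  have hq0 : 0 ≤ (obsLaw n (cubeMean δ (flipAt i σ))).real A := measureReal_nonneg
  set p := (obsLaw n (cubeMean δ σ)).real A
  set q := (obsLaw n (cubeMean δ (flipAt i σ))).real A
  set G := ∫ x in A, score n δ σ i x ∂obsLaw n (cubeMean δ σ)
  set G' := ∫ x in A, score n δ (flipAt i σ) i x ∂obsLaw n (cubeMean δ (flipAt i σ))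
  set κ := clipMean n δ
  have hdiff : (1 / 2 - κ) * (p - q) = G - G' := by rw [h1, h2]; linarith
  have hsq : (p - q) ^ 2 ≤ 32 * (G ^ 2 + G' ^ 2) := by
    have e : (1 / 2 - κ) ^ 2 * (p - q) ^ 2 = (G - G') ^ 2 := by rw [← hdiff]; ring
    have h16 : (1 : ℝ) / 16 ≤ (1 / 2 - κ) ^ 2 := by nlinarith
    nlinarith [mul_le_mul_of_nonneg_right h16 (sq_nonneg (p - q)), sq_nonneg (G + G')]
  rcases hp0.eq_or_lt with hp | hp
  · rcases hq0.eq_or_lt with hq | hq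
    · simp [← hp, ← hq]
    · have hG0 := z1 hp.symm
      rw [hG0] at hsq ⊢
      rw [← hp] at hsq ⊢
      rw [zero_add, div_le_iff₀ hq]
      have e : 32 * ((0 : ℝ) ^ 2 / 0 + G' ^ 2 / q) * q = 32 * G' ^ 2 := by field_simp; ring
      rw [e]; linarith
  · have hpq : 0 < p + q := by linarith
    have hG1 : G ^ 2 / (p + q) ≤ G ^ 2 / p := by gcongr; linarith
    have hG2 : G' ^ 2 / (p + q) ≤ G' ^ 2 / q := by
      rcases hq0.eq_or_lt with hq | hq
      · rw [z2 hq.symm]; simp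
      · gcongr; linarith
    calc _ ≤ 32 * (G ^ 2 + G' ^ 2) / (p + q) := by gcongr
      _ = 32 * (G ^ 2 / (p + q) + G' ^ 2 / (p + q)) := by ring
      _ ≤ _ := by gcongr

section Message

variable {n d : ℕ} {Y : Type*} [Fintype Y] [MeasurableSpace Y] [MeasurableSingletonClass Y]

/-- Flipping permutes the cube, so after summation over vertices both correlation terms contribute
equally: `64 = 2 * 32`. -/
lemma sum_triDiscr_le_sum_corr (hn : 0 < n) {δ : ℝ} (hδ : 0 ≤ δ) (hnδ : n * δ ^ 2 ≤ 1 / 32)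
    {f : (ℕ → ℝ) → Y} (hf : Measurable f) :
    ∑ σ : Fin d → Bool, ∑ i, triDiscr (fun y => (obsLaw n (cubeMean δ σ)).real (f ⁻¹' {y}))
        (fun y => (obsLaw n (cubeMean δ (flipAt i σ))).real (f ⁻¹' {y})) ≤
      64 * ∑ σ : Fin d → Bool, ∑ i, ∑ y, corr n δ σ i (f ⁻¹' {y}) := by
  rw [Finset.sum_comm, Finset.sum_comm (s := (Finset.univ : Finset (Fin d → Bool))),
    Finset.mul_sum]
  refine Finset.sum_le_sum fun i _ => ?_
  have h := sum_flipAt i fun σ => ∑ y, corr n δ σ i (f ⁻¹' {y})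
  calc _ ≤ ∑ σ : Fin d → Bool, ∑ y,
        32 * (corr n δ σ i (f ⁻¹' {y}) + corr n δ (flipAt i σ) i (f ⁻¹' {y})) :=
        Finset.sum_le_sum fun σ _ => Finset.sum_le_sum fun y _ =>
          sq_sub_div_add_le_corr hn hδ hnδ σ i (hf (measurableSet_singleton y))
    _ = _ := by
        simp_rw [← Finset.mul_sum, Finset.sum_add_distrib]
        rw [h]; ring

/-- A message carries at most as much information as the data. -/
lemma sum_corr_le_dim (hn : 0 < n) {δ : ℝ} (hδ : 0 ≤ δ) (hnδ : n * δ ^ 2 ≤ 1)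
    {f : (ℕ → ℝ) → Y} (hf : Measurable f) (σ : Fin d → Bool) :
    ∑ i, ∑ y, corr n δ σ i (f ⁻¹' {y}) ≤ d * (2 * (n * δ ^ 2)) := by
  calc _ ≤ ∑ _i : Fin d, 2 * (n * δ ^ 2) := Finset.sum_le_sum fun i _ =>
        (sum_sq_setIntegral_preimage_div_le hf (measurable_score n δ σ i)
          (abs_score_le n hδ σ i)).trans (integral_score_sq_le hn hδ hnδ σ i)
    _ = _ := by simp

/-- A message carries little information if it takes few values. -/
lemma sum_corr_le_log_card [Nonempty Y] (hn : 0 < n) {δ : ℝ} (hδ : 0 < δ)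
    {f : (ℕ → ℝ) → Y} (hf : Measurable f) (σ : Fin d → Bool) :
    ∑ i, ∑ y, corr n δ σ i (f ⁻¹' {y}) ≤ 4 * (n * δ ^ 2) * Real.log (Fintype.card Y) := by
  rw [Finset.sum_comm]
  calc _ ≤ ∑ y, 4 * (n * δ ^ 2) *
        Real.negMulLog ((obsLaw n (cubeMean δ σ)).real (f ⁻¹' {y})) :=
        Finset.sum_le_sum fun y _ => sum_sq_setIntegral_div_le (measurable_score n δ σ)
          (abs_score_le n hδ.le σ) (iIndepFun_score n δ σ) (by positivity)
          (integral_exp_score_le hn hδ.le σ)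
    _ ≤ _ := by
        rw [← Finset.mul_sum]
        gcongr
        exact sum_negMulLog_le (fun _ => measureReal_nonneg) (sum_measureReal_preimage hf)

end Message

/-! ### From minimax risk to Bayes risk at a fixed seed -/

lemma cubeMean_mem_ellipsoid {α c δ : ℝ} (hα : 0 < α) {d : ℕ}
    (hδ : (d : ℝ) ^ (2 * α + 1) * δ ^ 2 ≤ c ^ 2) (σ : Fin d → Bool) :
    cubeMean δ σ ∈ ellipsoid α c := by
  simp only [ellipsoid, Set.mem_ofPred_eq]
  rw [tsum_eq_sum (s := Finset.range d) fun i hi => by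
    have : ¬ i < d := by simpa using hi
    simp [cubeMean, this]]
  calc _ ≤ ∑ _i ∈ Finset.range d, ENNReal.ofReal ((d : ℝ) ^ (2 * α) * δ ^ 2) := by
        refine Finset.sum_le_sum fun i hi => ENNReal.ofReal_le_ofReal ?_
        have hid : i < d := Finset.mem_range.1 hi
        have e : cubeMean δ σ i ^ 2 = δ ^ 2 := by
          simp [cubeMean, hid, mul_pow, boolSign_sq]
        rw [e]
        gcongr
        exact_mod_cast hid
    _ = ENNReal.ofReal (d * ((d : ℝ) ^ (2 * α) * δ ^ 2)) := by
        rw [Finset.sum_const, Finset.card_range, nsmul_eq_mul,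
          ENNReal.ofReal_mul (p := (d : ℝ)) (by positivity), ENNReal.ofReal_natCast]
    _ ≤ _ := by
        refine ENNReal.ofReal_le_ofReal (le_trans (le_of_eq ?_) hδ)
        rcases Nat.eq_zero_or_pos d with rfl | hd
        · simp [Real.zero_rpow (by positivity : 2 * α + 1 ≠ 0)]
        · rw [Real.rpow_add_one (by positivity)]; ring

/-- Messages of independent machines are independent, so the law of the message vector is a product
on a finite space and the risk becomes a finite sum. -/
lemma lintegral_pi_messages {ι Ω : Type*} [Fintype ι] [MeasurableSpace Ω] {Y : ι → Type*}
    [∀ j, Fintype (Y j)] [DecidableEq ι] [∀ j, MeasurableSpace (Y j)]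
    [∀ j, MeasurableSingletonClass (Y j)]
    (μ : Measure Ω) [IsProbabilityMeasure μ] {f : ∀ j, Ω → Y j} (hf : ∀ j, Measurable (f j))
    {F : (∀ j, Y j) → ℝ} (hF : ∀ y, 0 ≤ F y) :
    ∫⁻ x : ι → Ω, ENNReal.ofReal (F fun j => f j (x j)) ∂Measure.pi (fun _ => μ) =
      ENNReal.ofReal (∑ y, (∏ j, μ.real (f j ⁻¹' {y j})) * F y) := by
  have hprob : ∀ j, IsProbabilityMeasure (μ.map (f j)) := fun j =>
    Measure.isProbabilityMeasure_map (hf j).aemeasurable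
  have hmap := Measure.pi_map_pi (μ := fun _ : ι => μ) (f := f) fun j => (hf j).aemeasurable
  have hmeas : Measurable fun (x : ι → Ω) j => f j (x j) :=
    measurable_pi_lambda _ fun j => (hf j).comp (measurable_pi_apply j)
  rw [← lintegral_map (f := fun y => ENNReal.ofReal (F y)) (measurable_of_finite _) hmeas, hmap,
    lintegral_fintype, ENNReal.ofReal_sum_of_nonneg fun y _ =>
      mul_nonneg (Finset.prod_nonneg fun j _ => measureReal_nonneg) (hF y)]
  refine Finset.sum_congr rfl fun y _ => ?_
  rw [Measure.pi_singleton, mul_comm, ENNReal.ofReal_mul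
    (Finset.prod_nonneg fun j _ => measureReal_nonneg),
    ENNReal.ofReal_prod_of_nonneg fun j _ => measureReal_nonneg]
  congr 1
  refine Finset.prod_congr rfl fun j _ => ?_
  rw [Measure.map_apply (hf j) (measurableSet_singleton _), ofReal_measureReal]

/-- Bayes risk over the cube `{-δ, δ} ^ d` for a fixed seed. -/
noncomputable def seedRisk {m : ℕ} (P : Protocol m) (n d : ℕ) (δ : ℝ) (w : P.Seed) : ℝ :=
  ∑ σ : Fin d → Bool, ∑ y : ∀ j, Fin (2 ^ P.bits j),
    (∏ j, (obsLaw n (cubeMean δ σ)).real (P.encode j w ⁻¹' {y j})) *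
      ∑ i : Fin d, (P.estimate w y i - δ * boolSign (σ i)) ^ 2

lemma Protocol.measurable_estimate_encode {m : ℕ} (P : Protocol m) (i : ℕ) :
    Measurable fun p : P.Seed × (Fin m → ℕ → ℝ) =>
      P.estimate p.1 (fun j => P.encode j p.1 (p.2 j)) i := by
  have h1 : Measurable fun q : P.Seed × (∀ j, Fin (2 ^ P.bits j)) => P.estimate q.1 q.2 i :=
    measurable_from_prod_countable_left fun y => P.measurable_estimate y i
  have h2 : Measurable fun p : P.Seed × (Fin m → ℕ → ℝ) =>
      (p.1, fun j => P.encode j p.1 (p.2 j)) := by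
    refine measurable_fst.prodMk (measurable_pi_lambda _ fun j => ?_)
    exact (P.measurable_encode j).comp
      (measurable_fst.prodMk ((measurable_pi_apply j).comp measurable_snd))
  exact h1.comp h2

lemma Protocol.measurable_encode_seed {m : ℕ} (P : Protocol m) (j : Fin m) (w : P.Seed) :
    Measurable (P.encode j w) :=
  (P.measurable_encode j).comp measurable_prodMk_left

/-- The minimax risk is at least the Bayes risk over a cube. -/
lemma ofReal_le_iSup_risk {m : ℕ} (P : Protocol m) {n d : ℕ} {Θ : Set (ℕ → ℝ)} {δ L : ℝ}
    (hΘ : ∀ σ : Fin d → Bool, cubeMean δ σ ∈ Θ) (hL : ∀ w, 2 ^ d * L ≤ seedRisk P n d δ w) :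
    ENNReal.ofReal L ≤ ⨆ θ ∈ Θ, P.risk n θ := by
  set S := ⨆ θ ∈ Θ, P.risk n θ
  let F : (Fin d → Bool) → P.Seed × (Fin m → ℕ → ℝ) → ℝ≥0∞ := fun σ p =>
    ENNReal.ofReal (∑ i : Fin d, (P.estimate p.1 (fun j => P.encode j p.1 (p.2 j)) i -
      δ * boolSign (σ i)) ^ 2)
  have hF : ∀ σ, Measurable (F σ) := fun σ => by
    refine ENNReal.measurable_ofReal.comp (Finset.measurable_sum _ fun i _ => ?_)
    exact ((P.measurable_estimate_encode i).sub_const _).pow_const 2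
  have hrisk : ∀ σ, ∫⁻ w, ∫⁻ x, F σ (w, x) ∂Measure.pi (fun _ : Fin m =>
      obsLaw n (cubeMean δ σ)) ∂P.seedLaw ≤ S := fun σ => by
    rw [← lintegral_prod _ (hF σ).aemeasurable]
    -- Only the first `d` coordinates of the error are kept.
    refine le_trans (lintegral_mono fun p => ?_) (le_iSup₂_of_le (cubeMean δ σ) (hΘ σ) le_rfl)
    simp only [F, sqError]
    rw [ENNReal.ofReal_sum_of_nonneg fun i _ => sq_nonneg _]
    have h1 := ENNReal.sum_le_tsum (f := fun i => ENNReal.ofReal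
      ((P.estimate p.1 (fun j => P.encode j p.1 (p.2 j)) i - cubeMean δ σ i) ^ 2)) (Finset.range d)
    rw [Finset.sum_range] at h1
    simp_rw [cubeMean_fin] at h1
    exact h1
  have hsum : ∑ _σ : Fin d → Bool, S = ENNReal.ofReal (2 ^ d) * S := by
    simp [ENNReal.ofReal_pow]
  have h2 : ENNReal.ofReal (2 ^ d) * ENNReal.ofReal L ≤ ENNReal.ofReal (2 ^ d) * S := by
    rw [← hsum, ← ENNReal.ofReal_mul (by positivity)]
    calc ENNReal.ofReal (2 ^ d * L) = ∫⁻ _w, ENNReal.ofReal (2 ^ d * L) ∂P.seedLaw := by simp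
      _ ≤ ∫⁻ w, ∑ σ, ∫⁻ x, F σ (w, x) ∂Measure.pi (fun _ : Fin m =>
            obsLaw n (cubeMean δ σ)) ∂P.seedLaw := by
          refine lintegral_mono fun w => (ENNReal.ofReal_le_ofReal (hL w)).trans_eq ?_
          unfold seedRisk
          rw [ENNReal.ofReal_sum_of_nonneg fun σ _ => Finset.sum_nonneg fun y _ =>
            mul_nonneg (Finset.prod_nonneg fun j _ => measureReal_nonneg)
              (Finset.sum_nonneg fun i _ => sq_nonneg _)]
          refine Finset.sum_congr rfl fun σ _ => ?_
          exact (lintegral_pi_messages (obsLaw n (cubeMean δ σ))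
            (fun j => P.measurable_encode_seed j w)
            (F := fun y => ∑ i : Fin d, (P.estimate w y i - δ * boolSign (σ i)) ^ 2)
            fun y => Finset.sum_nonneg fun i _ => sq_nonneg _).symm
      _ = ∑ σ, ∫⁻ w, ∫⁻ x, F σ (w, x) ∂Measure.pi (fun _ : Fin m =>
            obsLaw n (cubeMean δ σ)) ∂P.seedLaw :=
          lintegral_finsetSum _ fun σ _ => (hF σ).lintegral_prod_right'
      _ ≤ _ := Finset.sum_le_sum fun σ _ => hrisk σ
  rwa [ENNReal.mul_le_mul_iff_right (by simp) (by simp)] at h2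

/-! ### The three lower bounds at a fixed seed -/

section SeedRisk

variable {m : ℕ} (P : Protocol m) {n d : ℕ} {δ : ℝ}

lemma log_card_messages :
    Real.log (Fintype.card (∀ j, Fin (2 ^ P.bits j))) = (∑ j, (P.bits j : ℝ)) * Real.log 2 := by
  rw [Fintype.card_pi, Finset.sum_mul]
  push_cast
  rw [Real.log_prod fun j _ => by simp]
  simp

/-- Lower bound from the number of messages alone. -/
lemma seedRisk_ge_of_bits (hδ : 0 < δ) (w : P.Seed) :
    2 ^ d * (δ ^ 2 * (d - 2 * ((∑ j, (P.bits j : ℝ)) * Real.log 2))) ≤ seedRisk P n d δ w := by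
  rw [← log_card_messages]
  exact cube_risk_ge_of_card hδ _
    (fun σ y => Finset.prod_nonneg fun j _ => measureReal_nonneg)
    (fun σ => sum_prod_eq_one (p := fun j y =>
      (obsLaw n (cubeMean δ σ)).real (P.encode j w ⁻¹' {y}))
      fun j => sum_measureReal_preimage (P.measurable_encode_seed j w))
    fun y i => P.estimate w y i

/-- Assouad's bound with `V j` capping the information that machine `j` sends at any vertex. -/
lemma seedRisk_ge_of_corr (hn : 0 < n) (hδ : 0 ≤ δ) (hnδ : n * δ ^ 2 ≤ 1 / 32) (w : P.Seed)
    {V : Fin m → ℝ} (hV : ∀ j (σ : Fin d → Bool),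
      ∑ i, ∑ y, corr n δ σ i (P.encode j w ⁻¹' {y}) ≤ V j) :
    2 ^ d * (δ ^ 2 / 2 * (d - 64 * ∑ j, V j)) ≤ seedRisk P n d δ w := by
  have h := cube_risk_ge_of_triDiscr δ
    (fun (σ : Fin d → Bool) j y => (obsLaw n (cubeMean δ σ)).real (P.encode j w ⁻¹' {y}))
    (fun σ j y => measureReal_nonneg)
    (fun σ j => sum_measureReal_preimage (P.measurable_encode_seed j w))
    fun y i => P.estimate w y i
  refine le_trans ?_ h
  have h2 : ∑ σ : Fin d → Bool, ∑ i, ∑ j,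
      triDiscr (fun y => (obsLaw n (cubeMean δ σ)).real (P.encode j w ⁻¹' {y}))
        (fun y => (obsLaw n (cubeMean δ (flipAt i σ))).real (P.encode j w ⁻¹' {y})) ≤
      2 ^ d * (64 * ∑ j, V j) := by
    calc _ = ∑ j, ∑ σ : Fin d → Bool, ∑ i,
          triDiscr (fun y => (obsLaw n (cubeMean δ σ)).real (P.encode j w ⁻¹' {y}))
            (fun y => (obsLaw n (cubeMean δ (flipAt i σ))).real (P.encode j w ⁻¹' {y})) := by
          rw [Finset.sum_comm (s := (Finset.univ : Finset (Fin m)))]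
          exact Finset.sum_congr rfl fun σ _ => Finset.sum_comm
      _ ≤ ∑ j, 64 * ∑ _σ : Fin d → Bool, V j := Finset.sum_le_sum fun j _ =>
          (sum_triDiscr_le_sum_corr hn hδ hnδ (P.measurable_encode_seed j w)).trans
            (mul_le_mul_of_nonneg_left (Finset.sum_le_sum fun σ _ => hV j σ) (by norm_num))
      _ = _ := by
          rw [← Finset.mul_sum]
          simp only [Finset.sum_const, Finset.card_univ, Fintype.card_pi, Fintype.card_bool,
            Finset.prod_const, Fintype.card_fin, nsmul_eq_mul, ← Finset.mul_sum]
          push_cast; ring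
  have := mul_le_mul_of_nonneg_left h2 (by positivity : 0 ≤ δ ^ 2 / 2)
  linarith

/-- Lower bound from the amount of data alone. -/
lemma seedRisk_ge_of_samples (hn : 0 < n) (hδ : 0 ≤ δ) (hnδ : n * δ ^ 2 ≤ 1 / 32) (w : P.Seed) :
    2 ^ d * (δ ^ 2 / 2 * (d - 128 * d * (m * n * δ ^ 2))) ≤ seedRisk P n d δ w := by
  refine le_trans (le_of_eq ?_) (seedRisk_ge_of_corr P hn hδ hnδ w
    fun j σ => sum_corr_le_dim hn hδ (hnδ.trans (by norm_num)) (P.measurable_encode_seed j w) σ)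
  simp only [Finset.sum_const, Finset.card_univ, Fintype.card_fin, nsmul_eq_mul]
  ring

/-- Lower bound from the amount of data and the number of bits. -/
lemma seedRisk_ge_of_samples_of_bits (hn : 0 < n) (hδ : 0 < δ) (hnδ : n * δ ^ 2 ≤ 1 / 32)
    (w : P.Seed) :
    2 ^ d * (δ ^ 2 / 2 * (d - 256 * (n * δ ^ 2) * ((∑ j, (P.bits j : ℝ)) * Real.log 2))) ≤
      seedRisk P n d δ w := by
  refine le_trans (le_of_eq ?_) (seedRisk_ge_of_corr P hn hδ.le hnδ w
    fun j σ => sum_corr_le_log_card hn hδ (P.measurable_encode_seed j w) σ)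
  rw [← Finset.mul_sum]
  simp only [Fintype.card_fin, Nat.cast_pow, Nat.cast_ofNat, Real.log_pow, ← Finset.sum_mul]
  ring

end SeedRisk

/-! ### Choice of the dimension -/

lemma sum_bits_le {t : BudgetType} {m : ℕ} {b : ℝ} {P : Protocol m} (hP : P ∈ admissible t m b) :
    ∑ j, (P.bits j : ℝ) ≤ m * b := by
  cases t with
  | individual =>
    calc _ ≤ ∑ _j : Fin m, b := Finset.sum_le_sum fun j _ => hP j
      _ = m * b := by simp
  | sum => exact hP

/-- The squared half-width of the cube of dimension `d`. -/
noncomputable def cubeScale (α c : ℝ) (d : ℕ) : ℝ :=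
  min (c ^ 2) (1 / 512) / (d : ℝ) ^ (2 * α + 1)

lemma cubeScale_pos {α c : ℝ} (hc : 0 < c) {d : ℕ} (hd : 0 < d) : 0 < cubeScale α c d := by
  have : 0 < min (c ^ 2) (1 / 512) := lt_min (by positivity) (by norm_num)
  unfold cubeScale; positivity

lemma rpow_mul_cubeScale {α c : ℝ} {d : ℕ} (hd : 0 < d) :
    (d : ℝ) ^ (2 * α + 1) * cubeScale α c d = min (c ^ 2) (1 / 512) := by
  have : (0 : ℝ) < (d : ℝ) ^ (2 * α + 1) := by positivity
  unfold cubeScale; field_simp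

/-- The cube risk `δ ^ 2 * d / 4` is a constant times `d ^ (-2α)`, and `d ≤ 4 x` turns it into the
rate `x ^ (-2α)`. The cap `1 / 512` in `cubeScale` makes the factor `256` of
`seedRisk_ge_of_samples_of_bits` cost at most half of `d`. -/
lemma le_distMinimaxRisk {α c : ℝ} (hα : 0 < α) (hc : 0 < c) {t : BudgetType} {n m d : ℕ}
    {b x : ℝ} (hd : 0 < d) (hx : 0 < x) (hdx : d ≤ 4 * x)
    (h : ∀ P ∈ admissible t m b, ∀ w,
      2 ^ d * (cubeScale α c d * (d / 4)) ≤ seedRisk P n d √(cubeScale α c d) w) :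
    ENNReal.ofReal (min (c ^ 2) (1 / 512) / 4 / 4 ^ (2 * α)) ≤
      ENNReal.ofReal (x ^ (2 * α)) * distMinimaxRisk t n m b α c := by
  have hs := cubeScale_pos (α := α) hc hd
  have hc0 : 0 < min (c ^ 2) (1 / 512) := lt_min (by positivity) (by norm_num)
  have hR : ENNReal.ofReal (cubeScale α c d * (d / 4)) ≤ distMinimaxRisk t n m b α c := by
    refine le_iInf₂ fun P hP => ofReal_le_iSup_risk P (fun σ => ?_) (h P hP)
    refine cubeMean_mem_ellipsoid hα ?_ σ
    rw [Real.sq_sqrt hs.le, rpow_mul_cubeScale hd]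
    exact min_le_left _ _
  refine le_trans ?_ (mul_le_mul_right hR _)
  rw [← ENNReal.ofReal_mul (by positivity)]
  refine ENNReal.ofReal_le_ofReal ?_
  have hd' : (0 : ℝ) < d := by positivity
  have h1 : (d : ℝ) ^ (2 * α) ≤ 4 ^ (2 * α) * x ^ (2 * α) := by
    rw [← Real.mul_rpow (by norm_num) hx.le]
    exact Real.rpow_le_rpow hd'.le hdx (by positivity)
  have h2 : cubeScale α c d * (d / 4) = min (c ^ 2) (1 / 512) / 4 / (d : ℝ) ^ (2 * α) := by
    unfold cubeScale
    rw [Real.rpow_add_one hd'.ne']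
    field_simp
  rw [h2, mul_div_assoc', div_le_div_iff₀ (by positivity) (by positivity)]
  calc _ ≤ min (c ^ 2) (1 / 512) / 4 * (4 ^ (2 * α) * x ^ (2 * α)) := by gcongr
    _ = _ := by ring

/-- The dimension is four times the integer bit budget, so `2 B log 2 ≤ d / 2`; `m b ≥ 1` makes it
positive. -/
lemma le_distMinimaxRisk_of_bits {α c : ℝ} (hα : 0 < α) (hc : 0 < c) (t : BudgetType) (n : ℕ)
    {m : ℕ} {b : ℝ} (hmb : 1 ≤ m * b) :
    ENNReal.ofReal (min (c ^ 2) (1 / 512) / 4 / 4 ^ (2 * α)) ≤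
      ENNReal.ofReal ((m * b) ^ (2 * α)) * distMinimaxRisk t n m b α c := by
  have hfl : 0 < ⌊m * b⌋₊ := Nat.floor_pos.2 hmb
  have hd : 0 < 4 * ⌊m * b⌋₊ := by positivity
  refine le_distMinimaxRisk (d := 4 * ⌊m * b⌋₊) hα hc hd (by linarith) ?_ fun P hP w => ?_
  · have := Nat.floor_le (zero_le_one.trans hmb)
    push_cast; linarith
  · have hs := cubeScale_pos (α := α) hc hd
    refine le_trans ?_ (seedRisk_ge_of_bits P (Real.sqrt_pos.2 hs) w)
    rw [Real.sq_sqrt hs.le]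
    have hB : ∑ j, (P.bits j : ℝ) ≤ ⌊m * b⌋₊ := by
      have h1 : ((∑ j, P.bits j : ℕ) : ℝ) ≤ m * b := by push_cast; exact sum_bits_le hP
      exact_mod_cast Nat.le_floor h1
    have hlog : (∑ j, (P.bits j : ℝ)) * Real.log 2 ≤ ⌊m * b⌋₊ * 1 :=
      mul_le_mul hB (by have := Real.log_two_lt_d9; linarith) (Real.log_nonneg one_le_two)
        (by positivity)
    gcongr
    push_cast
    have : (0 : ℝ) ≤ ⌊m * b⌋₊ := by positivity
    linarith

/-- The dimension is the least integer with `m n ≤ d ^ (2α + 1)`, which forces `m n δ ^ 2 ≤ 1 /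
512`. -/
lemma le_distMinimaxRisk_of_samples {α c : ℝ} (hα : 0 < α) (hc : 0 < c) (t : BudgetType)
    {n m : ℕ} (hn : 0 < n) (hm : 0 < m) (b : ℝ) :
    ENNReal.ofReal (min (c ^ 2) (1 / 512) / 4 / 4 ^ (2 * α)) ≤
      ENNReal.ofReal (((m : ℝ) * n) ^ (2 * α / (2 * α + 1))) * distMinimaxRisk t n m b α c := by
  have hmn : (1 : ℝ) ≤ m * n := by exact_mod_cast Nat.mul_pos hm hn
  have hm1 : (1 : ℝ) ≤ m := by exact_mod_cast hm
  set x : ℝ := ((m : ℝ) * n) ^ (1 / (2 * α + 1)) with hx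
  have hx1 : 1 ≤ x := Real.one_le_rpow hmn (by positivity)
  have hxp : x ^ (2 * α + 1) = m * n := by
    rw [hx, ← Real.rpow_mul (by positivity), one_div_mul_cancel (by positivity), Real.rpow_one]
  have hxr : ((m : ℝ) * n) ^ (2 * α / (2 * α + 1)) = x ^ (2 * α) := by
    rw [hx, ← Real.rpow_mul (by positivity)]; congr 1; ring
  have hd : 0 < ⌈x⌉₊ := Nat.ceil_pos.2 (by linarith)
  rw [hxr]
  refine le_distMinimaxRisk (d := ⌈x⌉₊) hα hc hd (by linarith) ?_ fun P hP w => ?_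
  · have := Nat.ceil_lt_add_one (zero_le_one.trans hx1); linarith
  have hs := cubeScale_pos (α := α) hc hd
  have hmns : m * n * cubeScale α c ⌈x⌉₊ ≤ 1 / 512 := by
    calc _ ≤ (⌈x⌉₊ : ℝ) ^ (2 * α + 1) * cubeScale α c ⌈x⌉₊ := by
          rw [← hxp]
          gcongr
          exact Nat.le_ceil x
      _ ≤ _ := by rw [rpow_mul_cubeScale hd]; exact min_le_right _ _
  have hns : n * cubeScale α c ⌈x⌉₊ ≤ 1 / 512 := by
    refine le_trans ?_ hmns
    rw [mul_assoc]
    exact le_mul_of_one_le_left (by positivity) hm1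
  refine le_trans ?_ (seedRisk_ge_of_samples P hn (Real.sqrt_nonneg _)
    (by rw [Real.sq_sqrt hs.le]; linarith) w)
  rw [Real.sq_sqrt hs.le]
  have hd0 : (0 : ℝ) ≤ ⌈x⌉₊ := by positivity
  have h3 := mul_le_mul_of_nonneg_left hmns hd0
  rw [div_mul_eq_mul_div, ← mul_div_assoc (cubeScale α c ⌈x⌉₊),
    mul_div_assoc _ _ (4 : ℝ), mul_div_assoc _ _ (2 : ℝ)]
  gcongr _ * (_ * ?_)
  linarith

/-- Here `x ^ (2α + 2) = m n b` balances `n δ ^ 2 * (m b)` against `d`. -/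
lemma le_distMinimaxRisk_of_samples_of_bits {α c : ℝ} (hα : 0 < α) (hc : 0 < c) (t : BudgetType)
    {n m : ℕ} {b : ℝ} (hn : 0 < n) (hmb : 1 ≤ m * b)
    (hreg : (n : ℝ) ^ (1 / (2 * α + 1)) ≤ m * b) :
    ENNReal.ofReal (min (c ^ 2) (1 / 512) / 4 / 4 ^ (2 * α)) ≤
      ENNReal.ofReal (((m : ℝ) * n * b) ^ (α / (α + 1))) * distMinimaxRisk t n m b α c := by
  have hn1 : (1 : ℝ) ≤ n := by exact_mod_cast hn
  have hmnb : (m : ℝ) * n * b = n * (m * b) := by ring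
  have hmnb1 : 1 ≤ (m : ℝ) * n * b := by rw [hmnb]; exact one_le_mul_of_one_le_of_one_le hn1 hmb
  set x : ℝ := ((m : ℝ) * n * b) ^ (1 / (2 * α + 2)) with hx
  have hx1 : 1 ≤ x := Real.one_le_rpow hmnb1 (by positivity)
  have hxp : x ^ (2 * α + 2) = m * n * b := by
    rw [hx, ← Real.rpow_mul (by positivity), one_div_mul_cancel (by positivity), Real.rpow_one]
  have hxr : ((m : ℝ) * n * b) ^ (α / (α + 1)) = x ^ (2 * α) := by
    rw [hx, ← Real.rpow_mul (by positivity)]; congr 1; field_simp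
  -- The regime condition `hreg` enters here: it makes one machine's signal `n δ ^ 2` small, as the
  -- score argument requires.
  have hxn : (n : ℝ) ≤ x ^ (2 * α + 1) := by
    have h1 : (n : ℝ) ^ ((2 * α + 2) / (2 * α + 1)) ≤ m * n * b := by
      have e : (2 * α + 2) / (2 * α + 1) = 1 + 1 / (2 * α + 1) := by field_simp; ring
      rw [e, Real.rpow_add (by positivity), Real.rpow_one, hmnb]
      gcongr
    rw [← hxp] at h1
    have h2 := Real.rpow_le_rpow (by positivity) h1
      (by positivity : 0 ≤ (2 * α + 1) / (2 * α + 2))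
    rw [← Real.rpow_mul (by positivity), ← Real.rpow_mul (by positivity)] at h2
    have e1 : (2 * α + 2) / (2 * α + 1) * ((2 * α + 1) / (2 * α + 2)) = 1 := by field_simp
    have e2 : (2 * α + 2) * ((2 * α + 1) / (2 * α + 2)) = 2 * α + 1 := by field_simp
    rwa [e1, e2, Real.rpow_one] at h2
  have hd : 0 < ⌈x⌉₊ := Nat.ceil_pos.2 (by linarith)
  rw [hxr]
  refine le_distMinimaxRisk (d := ⌈x⌉₊) hα hc hd (by linarith) ?_ fun P hP w => ?_
  · have := Nat.ceil_lt_add_one (zero_le_one.trans hx1); linarith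
  have hs := cubeScale_pos (α := α) hc hd
  have hscale : (⌈x⌉₊ : ℝ) ^ (2 * α + 1) * cubeScale α c ⌈x⌉₊ ≤ 1 / 512 := by
    rw [rpow_mul_cubeScale hd]; exact min_le_right _ _
  have hns : n * cubeScale α c ⌈x⌉₊ ≤ 1 / 512 := by
    refine le_trans ?_ hscale
    gcongr
    exact hxn.trans (Real.rpow_le_rpow (by positivity) (Nat.le_ceil x) (by positivity))
  have hd0 : (0 : ℝ) < ⌈x⌉₊ := by positivity
  have hB0 : 0 ≤ ∑ j, (P.bits j : ℝ) := Finset.sum_nonneg fun j _ => by positivity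
  have hnsB : n * cubeScale α c ⌈x⌉₊ * ∑ j, (P.bits j : ℝ) ≤ ⌈x⌉₊ / 512 := by
    calc _ ≤ n * cubeScale α c ⌈x⌉₊ * (m * b) := by
          gcongr
          exact sum_bits_le hP
      _ = x ^ (2 * α + 2) * cubeScale α c ⌈x⌉₊ := by rw [hxp]; ring
      _ ≤ (⌈x⌉₊ : ℝ) ^ (2 * α + 2) * cubeScale α c ⌈x⌉₊ := by
          gcongr
          exact Nat.le_ceil x
      _ = ⌈x⌉₊ * ((⌈x⌉₊ : ℝ) ^ (2 * α + 1) * cubeScale α c ⌈x⌉₊) := by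
          have e : 2 * α + 2 = 2 * α + 1 + 1 := by ring
          rw [e, Real.rpow_add_one hd0.ne']; ring
      _ ≤ ⌈x⌉₊ * (1 / 512) := by gcongr
      _ = _ := by ring
  refine le_trans ?_ (seedRisk_ge_of_samples_of_bits P hn (Real.sqrt_pos.2 hs)
    (by rw [Real.sq_sqrt hs.le]; linarith) w)
  rw [Real.sq_sqrt hs.le]
  have hlog0 : 0 ≤ Real.log 2 := Real.log_nonneg one_le_two
  have hlog1 : Real.log 2 ≤ 1 := by have := Real.log_two_lt_d9; linarith
  have h4 : n * cubeScale α c ⌈x⌉₊ * ((∑ j, (P.bits j : ℝ)) * Real.log 2) ≤ ⌈x⌉₊ / 512 := by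
    rw [← mul_assoc]
    exact (mul_le_of_le_one_right (by positivity) hlog1).trans hnsB
  have h5 : (⌈x⌉₊ : ℝ) / 2 ≤
      ⌈x⌉₊ - 256 * (n * cubeScale α c ⌈x⌉₊) * ((∑ j, (P.bits j : ℝ)) * Real.log 2) := by linarith
  calc _ = 2 ^ ⌈x⌉₊ * (cubeScale α c ⌈x⌉₊ / 2 * (⌈x⌉₊ / 2)) := by ring
    _ ≤ _ := by gcongr

end DistEst

theorem theorem1 (α c : ℝ) (hα : 0 < α) (hc : 0 < c) :
    ∃ C : ℝ, 0 < C ∧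
      ∀ (t : DistEst.BudgetType) (n m : ℕ → ℕ) (b : ℕ → ℝ),
        (∀ k, 0 < n k) → (∀ k, 0 < m k) → (∀ k, 1 ≤ (m k : ℝ) * b k) →
        Tendsto (fun k => (m k : ℝ) * n k) atTop atTop →
        (Tendsto (fun k => b k * ((m k : ℝ) * n k) ^ (-(1 / (2 * α + 1)))) atTop atTop →
          ENNReal.ofReal C ≤
            liminf (fun k => ENNReal.ofReal (((m k : ℝ) * n k) ^ (2 * α / (2 * α + 1))) *
              DistEst.distMinimaxRisk t (n k) (m k) (b k) α c) atTop) ∧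
        ((fun k => b k * ((m k : ℝ) * n k) ^ (-(1 / (2 * α + 1)))) =O[atTop]
            (fun _ => (1 : ℝ)) →
          Tendsto (fun k => (m k : ℝ) * b k * (n k : ℝ) ^ (-(1 / (2 * α + 1)))) atTop atTop →
          ENNReal.ofReal C ≤
            liminf (fun k => ENNReal.ofReal (((m k : ℝ) * n k * b k) ^ (α / (α + 1))) *
              DistEst.distMinimaxRisk t (n k) (m k) (b k) α c) atTop) ∧
        ((fun k => (m k : ℝ) * b k * (n k : ℝ) ^ (-(1 / (2 * α + 1)))) =O[atTop]
            (fun _ => (1 : ℝ)) →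
          ENNReal.ofReal C ≤
            liminf (fun k => ENNReal.ofReal (((m k : ℝ) * b k) ^ (2 * α)) *
              DistEst.distMinimaxRisk t (n k) (m k) (b k) α c) atTop) := by
  have hc0 : 0 < min (c ^ 2) (1 / 512) := lt_min (by positivity) (by norm_num)
  refine ⟨min (c ^ 2) (1 / 512) / 4 / 4 ^ (2 * α), by positivity, ?_⟩
  intro t n m b hn hm hmb _
  refine ⟨fun _ => ?_, fun _ hreg => ?_, fun _ => ?_⟩
  · exact le_liminf_of_le (by isBoundedDefault) (.of_forall fun k =>
      DistEst.le_distMinimaxRisk_of_samples hα hc t (hn k) (hm k) (b k))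
  · refine le_liminf_of_le (by isBoundedDefault) ?_
    -- Divergence of this ratio gives `n ^ (1 / (2α + 1)) ≤ m b` for all large `k`.
    filter_upwards [hreg.eventually_ge_atTop 1] with k hk
    refine DistEst.le_distMinimaxRisk_of_samples_of_bits hα hc t (hn k) (hmb k) ?_
    have hnk : (0 : ℝ) < n k := by exact_mod_cast hn k
    rwa [Real.rpow_neg hnk.le, ← div_eq_mul_inv, le_div_iff₀ (by positivity), one_mul] at hk
  · exact le_liminf_of_le (by isBoundedDefault) (.of_forall fun k =>
      DistEst.le_distMinimaxRisk_of_bits hα hc t (n k) (hmb k))
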